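/- **Theorem 1 (Implicit regularization).** Let $(a_{ij})_{1\le j<i\le s}$, $(b_i)_{i\le s}$, $(c_i)_{i\le s}$ be the coefficients of an explicit $s$-stage Runge–Kutta scheme of order $p\ge 1$; that is, for every dimension and every smooth problem $\dot y=g(y,t)$ the error of one step started on a solution is $\mathcal O(h^{p+1})$ as $h\to0^+$ (for example a $p$-stage scheme of order $p$). Let $d\ge 0$. For $f:\mathbb R^d\times\mathbb R^q\to\mathbb R^d$, $\theta:\mathbb R\to\mathbb R^q$, $y_0\in\mathbb R^d$ and $h>0$, let $y_{h,\theta}$ be the piecewise linear interpolation of the values at the grid points $0,h,2h,\dots$ given by $y_{h,\theta}(0)=y_0$ and $$y_{h,\theta}(t+h)=y_{h,\theta}(t)+h\sum_{i=1}^s b_i k_i,\qquad k_i=f\Big(y_{h,\theta}(t)+h\sum_{j<i}a_{ij}k_j,\ \theta(t+c_ih)\Big),\qquad t\in\{0,h,2h,\dots\},$$ and write $\iota_h(t)=\lfloor t/h\rfloor h$. Let $$\mathcal D^p_{h,\theta}(t)=\Big\{h^{-m}\Delta_h^m\,\frac{\partial^l f_j}{\partial y_{i_1}\cdots\partial y_{i_l}}\big(y_{h,\theta}(t),\theta(\iota_h(t))\big)\Big\}_{1\le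 j,i_1,\dots,i_l\le d,\ l+m\le p+1},$$ where $\Delta_h^m$ is the $m$-th forward difference in time with the state held fixed: with $\Delta_h^0F=F$ and $\Delta_h^mF(\tau)=\Delta_h^{m-1}F(\tau+h)-\Delta_h^{m-1}F(\tau)$, it is applied to $F(\tau)=\frac{\partial^l f_j}{\partial y_{i_1}\cdots\partial y_{i_l}}(x,\theta(\tau))$ and evaluated at $\tau=\iota_h(t)$, $x=y_{h,\theta}(t)$. There is a polynomial $P$ with values in $\mathbb R^d$ and $P(0)=0$, depending only on the scheme (with its order $p$) and on the dimension $d$, such that the following holds for all $q$, $f$, $\theta$, $y_0$ and $T>0$ for which $(y,t)\mapsto f(y,\theta(t))$ is $C^\infty$ on $\mathbb R^d\times\mathbb R$ and the problem $\dot y=f(y,\theta(t))$, $y(0)=y_0$, has a solution on $[0,T]$. There are a $C^\infty$ function $\bar y_\theta:[0,T]\to\mathbb R^d$, not depending on $h$, and, for each $h>0$, a continuous $e_{h,\theta}:[0,T]\to\mathbb R^d$ with $e_{h,\theta}(0)=0$ and $$\dot e_{h,\theta}(t)=\frac{\partial f}{\partial y}\big(y_{h,\theta}(t),\theta(\iota_h(t))\big)\,e_{h,\theta}(t)+P\big(\mathcal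 D^p_{h,\theta}(t)\big)$$ on $[0,T)$ (right derivative at the grid points, where the right side may jump), such that for every $C^2$ function $L:\mathbb R^d\to\mathbb R$, as $h\to0^+$, $$L(y_{h,\theta}(t))=L(\bar y_\theta(t))+h^p\,\nabla L(\bar y_\theta(t))\cdot e_{h,\theta}(t)+\mathcal O(h^{p+1}),$$ uniformly over the grid points $t\in\{0,h,2h,\dots\}\cap[0,T]$; if $p=1$, uniformly over all $t\in[0,T]$. -/

import Mathlib

open Set Filter Topology
open scoped ContDiff

/-- The state space `ℝᵈ` with its Euclidean norm. -/
abbrev State (d : ℕ) : Type := EuclideanSpace ℝ (Fin d)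

/-- The coefficients of an explicit Runge--Kutta scheme with `s` stages: only the entries `a i j`
with `j < i` are ever used. -/
structure RKScheme (s : ℕ) where
  a : Fin s → Fin s → ℝ
  b : Fin s → ℝ
  c : Fin s → ℝ

namespace RKScheme

variable {s d : ℕ} {W : Type*}

/-- The stages `kᵢ(t, y) = f (y + h ∑_{j < i} aᵢⱼ kⱼ(t, y), θ (t + cᵢ h))`. -/
noncomputable def stage (S : RKScheme s) (f : State d → W → State d) (θ : ℝ → W)
    (h t : ℝ) (y : State d) (i : Fin s) : State d :=
  f (y + h • ∑ j : Fin i.val,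
      S.a i ⟨j.val, j.isLt.trans i.isLt⟩ •
        stage S f θ h t y ⟨j.val, j.isLt.trans i.isLt⟩)
    (θ (t + S.c i * h))
termination_by i.val
decreasing_by exact j.isLt

/-- The increment function `Φ_h(t, y) = ∑ᵢ bᵢ kᵢ(t, y)`. -/
noncomputable def increment (S : RKScheme s) (f : State d → W → State d) (θ : ℝ → W)
    (h t : ℝ) (y : State d) : State d :=
  ∑ i, S.b i • S.stage f θ h t y i

/-- The scheme has order (at least) `p`: for every smooth problem `ẏ = g(y, t)`, in every
dimension, the error of one step that starts on a solution is `O(h^(p+1))` as `h → 0⁺`. -/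
def HasOrder (S : RKScheme s) (p : ℕ) : Prop :=
  ∀ (d : ℕ) (g : State d → ℝ → State d),
    ContDiff ℝ ∞ (fun x : State d × ℝ => g x.1 x.2) →
    ∀ (t₀ : ℝ) (y : ℝ → State d),
      (∀ᶠ t in 𝓝 t₀, HasDerivAt y (g (y t) t) t) →
      (fun h : ℝ => y (t₀ + h) - (y t₀ + h • S.increment g (fun t => t) h t₀ (y t₀)))
        =O[𝓝[>] (0 : ℝ)] (fun h : ℝ => h ^ (p + 1))

/-- The values produced by the scheme at the grid points `0, h, 2h, …`. -/
noncomputable def node (S : RKScheme s) (f : State d → W → State d) (θ : ℝ → W)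
    (y₀ : State d) (h : ℝ) : ℕ → State d
  | 0 => y₀
  | n + 1 => node S f θ y₀ h n + h • S.increment f θ h (n * h) (node S f θ y₀ h n)

/-- The numerical solution `y_{h,θ}(t)`: the grid values joined by linear interpolation. -/
noncomputable def approx (S : RKScheme s) (f : State d → W → State d) (θ : ℝ → W)
    (y₀ : State d) (h t : ℝ) : State d :=
  AffineMap.lineMap (S.node f θ y₀ h ⌊t / h⌋₊) (S.node f θ y₀ h (⌊t / h⌋₊ + 1))
    (t / h - ⌊t / h⌋₊)

end RKScheme

/-- The grid point `ι_h(t) = ⌊t / h⌋ h`. -/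
noncomputable def gridPoint (h t : ℝ) : ℝ := ⌊t / h⌋₊ * h

/-- Indices of the scaled mixed differences of total order at most `N`: a component `j` of the
vector field, the order `m` of the forward difference in time, the order `l` of the derivative in
the state, and the `l` coordinate directions in which that derivative is taken. -/
structure DiffIndex (d N : ℕ) where
  j : Fin d
  m : ℕ
  l : ℕ
  dir : Fin l → Fin d
  le : l + m ≤ N

/-- The quantities `h^(-m) Δ_h^m (∂^l f_j / ∂y_{i₁} ⋯ ∂y_{i_l})(x, θ(τ))`. The forward differences
act on the time `τ`, the state `x` being held fixed. -/
noncomputable def scaledDiff {d N : ℕ} {W : Type*} (f : State d → W → State d) (θ : ℝ → W)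
    (h τ : ℝ) (x : State d) (k : DiffIndex d N) : ℝ :=
  (h ^ k.m)⁻¹ *
    (fwdDiff h)^[k.m]
      (fun σ : ℝ => iteratedFDeriv ℝ k.l (fun y : State d => f y (θ σ) k.j) x
        (fun r => EuclideanSpace.single (k.dir r) (1 : ℝ))) τ

/-- Evaluation of a vector of `d` polynomials, as an element of `ℝᵈ`. -/
noncomputable def evalPoly {d : ℕ} {ι : Type*} (P : Fin d → MvPolynomial ι ℝ) (v : ι → ℝ) :
    State d :=
  WithLp.toLp 2 fun i => MvPolynomial.eval v (P i)

/-- `e` solves on `[0, T]` the linear variational equation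
`ė(t) = ∂f/∂y (x(t), θ(ι_h(t))) e(t) + P(𝒟(t))`, `e(0) = 0`, along the curve `x`, where `𝒟(t)` is
the family of scaled mixed differences of total order at most `N` at `(x(t), θ(ι_h(t)))`. The right
side jumps at the grid points, so the derivative is the right derivative (away from the grid it is
the derivative, `e` and the right side being continuous there). -/
def SolvesVariational {d N : ℕ} {W : Type*} (f : State d → W → State d) (θ : ℝ → W)
    (P : Fin d → MvPolynomial (DiffIndex d N) ℝ) (h T : ℝ) (x e : ℝ → State d) : Prop :=
  ContinuousOn e (Icc 0 T) ∧ e 0 = 0 ∧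
    ∀ t ∈ Ico (0 : ℝ) T,
      HasDerivWithinAt e
        (fderiv ℝ (fun y : State d => f y (θ (gridPoint h t))) (x t) (e t)
          + evalPoly P (scaledDiff f θ h (gridPoint h t) (x t)))
        (Ici t) t

/-! ### Uniform bounds on balls, Taylor's formula, iterated differences. -/

section Preliminaries

variable {E F : Type*} [NormedAddCommGroup E] [NormedAddCommGroup F]

/-! Write `g(x, t) = f(x, θ(t))`; only `g` matters, and `ȳ` is the exact solution `y`. The proof has
two halves.

Local error. Near `(y(t), t)` replace `g` by its Taylor polynomial of total degree `p + 1`, with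
partial derivatives `u`, and replace the exact increment by the Picard iterate number `p + 1` of
that polynomial field. Both changes cost `O(h^(p+2))`. What remains, `localDefect`, is a polynomial
in `u` and `h`, because Picard iteration integrates polynomials and an explicit scheme only composes
them. Order `p` forces its coefficients of `h^k`, `k ≤ p`, to vanish at the jets met along `y`, and
`P` is minus its coefficient of `h^(p+1)`. So `P` is universal, it vanishes at `0` because the zero
field has no defect, and the remainder is uniform in `t` although the order condition is only
pointwise (`exists_principal_localError`).

Global error. A Grönwall argument first gives `E_n = X_n - y(nh) = O(h^p)` at the nodes `X_n`.
Consistency (`∑ bᵢ = 1`) makes the increment function at `h = 0` equal to `g`, so `E_(n+1) = E_n + h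
A E_n + h^(p+1) P(jet) + O(h^(p+2))` with `A = ∂g/∂y` at `(y(nh), nh)`. The coefficients of the
equation for `e` are taken along the numerical solution and use differences, but they are within
`O(h)` of `A` and `P(jet)`, so `h^p e` obeys the same recursion up to `O(h^(p+2))`. A second
Grönwall argument gives `E_n - h^p e(nh) = O(h^(p+1))` (`exists_globalError_expansion`). Linear
interpolation costs a further `O(h^2)` between grid points, which is harmless exactly when `p = 1`.
A Taylor expansion of `L` finishes the proof. -/

theorem Continuous.exists_norm_le_of_norm_le [ProperSpace E] {φ : E → F} (hφ : Continuous φ)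
    (R : ℝ) : ∃ C, 0 ≤ C ∧ ∀ x, ‖x‖ ≤ R → ‖φ x‖ ≤ C := by
  obtain ⟨C, hC⟩ := (isCompact_closedBall (0 : E) R).exists_bound_of_continuousOn hφ.continuousOn
  exact ⟨max C 0, le_max_right _ _, fun x hx => (hC x (by simpa using hx)).trans (le_max_left _ _)⟩

variable [NormedSpace ℝ E] [NormedSpace ℝ F]

theorem ContDiff.exists_norm_sub_le_of_norm_le [ProperSpace E] {φ : E → F}
    (hφ : ContDiff ℝ 1 φ) (R : ℝ) :
    ∃ C, 0 ≤ C ∧ ∀ x y, ‖x‖ ≤ R → ‖y‖ ≤ R → ‖φ x - φ y‖ ≤ C * ‖x - y‖ := by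
  obtain ⟨C, hC0, hC⟩ := (hφ.continuous_fderiv one_ne_zero).exists_norm_le_of_norm_le R
  refine ⟨C, hC0, fun x y hx hy => ?_⟩
  refine (convex_closedBall (0 : E) R).norm_image_sub_le_of_norm_fderiv_le (𝕜 := ℝ)
    (fun z _ => (hφ.differentiable one_ne_zero) z) (fun z hz => hC z (by simpa using hz))
    (by simpa using hy) (by simpa using hx)

/-- The second order Taylor estimate on a ball. -/
theorem ContDiff.exists_norm_sub_sub_fderiv_le [ProperSpace E] {φ : E → F}
    (hφ : ContDiff ℝ 2 φ) (R : ℝ) :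
    ∃ C, 0 ≤ C ∧ ∀ x y, ‖x‖ ≤ R → ‖y‖ ≤ R →
      ‖φ y - φ x - fderiv ℝ φ x (y - x)‖ ≤ C * ‖y - x‖ ^ 2 := by
  obtain ⟨C, hC0, hC⟩ :=
    ((hφ.fderiv_right (m := 1) (by norm_num)).exists_norm_sub_le_of_norm_le R)
  refine ⟨C, hC0, fun x y hx hy => ?_⟩
  have hd : Differentiable ℝ φ := hφ.differentiable two_ne_zero
  have hball : ∀ z ∈ segment ℝ x y, ‖z‖ ≤ R := fun z hz => by
    have := (convex_closedBall (0 : E) R).segment_subset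
      (by simpa using hx : x ∈ Metric.closedBall 0 R) (by simpa using hy) hz
    simpa using this
  have := (convex_segment x y).norm_image_sub_le_of_norm_fderiv_le' (𝕜 := ℝ) (f := φ)
    (φ := fderiv ℝ φ x) (C := C * ‖y - x‖)
    (fun z _ => hd z) (fun z hz => (hC z x (hball z hz) hx).trans ?_)
    (left_mem_segment ℝ x y) (right_mem_segment ℝ x y)
  · rw [pow_two, ← mul_assoc]; exact this
  · gcongr
    rw [norm_sub_rev z x, norm_sub_rev y x, ← dist_eq_norm, ← dist_eq_norm]
    linarith [dist_add_dist_of_mem_segment hz, dist_nonneg (x := z) (y := y)]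

/-- Taylor's formula with integral remainder along a segment. The factors `1 / n!` and `(1 - t) ^ n`
are bounded by `1`, since only the order of the remainder will matter. -/
theorem norm_sub_sum_iteratedFDeriv_le {φ : E → ℝ} (hφ : ContDiff ℝ ∞ φ) (n : ℕ) (x y : E)
    {B : ℝ} (hB : ∀ r ∈ Icc (0 : ℝ) 1, |iteratedFDeriv ℝ (n + 1) φ (x + r • y) (fun _ => y)| ≤ B) :
    |φ (x + y) - ∑ k ∈ Finset.range (n + 1),
      (k.factorial : ℝ)⁻¹ * iteratedFDeriv ℝ k φ x (fun _ => y)| ≤ B := by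
  have hB0 : 0 ≤ B := (abs_nonneg _).trans (hB 0 (by simp))
  have hT := map_add_eq_sum_add_integral_iteratedFDeriv (f := φ) (x := x) (y := y) (n := n)
    fun t _ => (hφ.of_le (by exact_mod_cast le_top)).contDiffAt
  rw [hT]
  simp only [smul_eq_mul, add_sub_cancel_left]
  rw [abs_mul]
  have h1 : |∫ t in (0 : ℝ)..1, (1 - t) ^ n * iteratedFDeriv ℝ (n + 1) φ (x + t • y) (fun _ => y)|
      ≤ B * |(1 : ℝ) - 0| := by
    rw [← Real.norm_eq_abs]
    refine intervalIntegral.norm_integral_le_of_norm_le_const fun t ht => ?_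
    rw [uIoc_of_le zero_le_one] at ht
    rw [Real.norm_eq_abs, abs_mul, abs_pow, abs_of_nonneg (by linarith [ht.2] : 0 ≤ 1 - t)]
    calc _ ≤ 1 * B := by
          gcongr
          · exact pow_le_one₀ (by linarith [ht.2]) (by linarith [ht.1])
          · exact hB t ⟨ht.1.le, ht.2⟩
      _ = B := one_mul B
  have h2 : |((n.factorial : ℝ))⁻¹| ≤ 1 := by
    rw [abs_of_nonneg (by positivity)]
    exact inv_le_one_of_one_le₀ (by exact_mod_cast n.factorial_pos)
  calc _ ≤ 1 * (B * |(1 : ℝ) - 0|) := by gcongr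
    _ = B := by simp

/-- Iterated mean value theorem: differencing commutes with differentiation, so each step trades one
difference of `φ` for `h` times a lower difference of `deriv φ`. This links the scaled differences
in the statement to true time derivatives. -/
theorem fwdDiff_iterate_eq_iteratedDeriv {h : ℝ} (hh : 0 < h) (m : ℕ) :
    ∀ {φ : ℝ → ℝ}, ContDiff ℝ ∞ φ → ∀ τ : ℝ,
      ∃ ξ ∈ Icc τ (τ + m * h), (fwdDiff h)^[m] φ τ = h ^ m * iteratedDeriv m φ ξ := by
  induction m with
  | zero => intro φ _ τ; exact ⟨τ, by simp, by simp⟩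
  | succ m ih =>
    intro φ hφ τ
    -- As a finite combination of translates of `φ`, the iterated difference can be differentiated
    -- term by term.
    have hsum : (fwdDiff h)^[m] φ = fun y => ∑ k ∈ Finset.range (m + 1),
        ((-1 : ℤ) ^ (m - k) * m.choose k) • φ (y + k • h) :=
      funext fun y => fwdDiff_iter_eq_sum_shift h φ m y
    have hd : ∀ y, HasDerivAt ((fwdDiff h)^[m] φ) ((fwdDiff h)^[m] (deriv φ) y) y := by
      intro y
      rw [hsum, fwdDiff_iter_eq_sum_shift]
      refine HasDerivAt.fun_sum fun k _ => ?_
      have h0 : HasDerivAt φ (deriv φ (y + k • h)) (y + k • h) :=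
        (hφ.differentiable (by simp) _).hasDerivAt
      have h1 := (h0.comp_add_const y (k • h)).const_smul
        ((((-1 : ℤ) ^ (m - k) * m.choose k : ℤ)) : ℝ)
      simp only [zsmul_eq_mul]
      exact h1
    obtain ⟨c, hc, hc'⟩ := exists_hasDerivAt_eq_slope ((fwdDiff h)^[m] φ) _
      (by linarith : τ < τ + h) (fun y _ => (hd y).continuousAt.continuousWithinAt)
      (fun y _ => hd y)
    obtain ⟨ξ, hξ, hξ'⟩ := ih (contDiff_infty_iff_deriv.1 hφ).2 c
    refine ⟨ξ, ⟨hc.1.le.trans hξ.1, ?_⟩, ?_⟩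
    · push_cast
      linarith [hξ.2, hc.2]
    · rw [Function.iterate_succ_apply', fwdDiff, iteratedDeriv_succ', pow_succ', mul_assoc, ← hξ',
        hc', add_sub_cancel_left, mul_div_cancel₀ _ hh.ne']

end Preliminaries

/-! ### Linear equations whose right side may jump at grid points. -/

section LinearODE

variable {E : Type*} [NormedAddCommGroup E] [NormedSpace ℝ E]

/-- `e` is a continuous solution of `ė = v(t, e)` on `[a, c]`, in the sense of right derivatives. -/
def IsRightSolution (v : ℝ → E → E) (a c : ℝ) (e : ℝ → E) : Prop :=
  ContinuousOn e (Icc a c) ∧ ∀ t ∈ Ico a c, HasDerivWithinAt e (v t (e t)) (Ici t) t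

/-- At the junction only the right derivative is required, and it is determined by the second piece
alone. The field may therefore be discontinuous there. -/
theorem IsRightSolution.glue {v : ℝ → E → E} {a b c : ℝ} (hab : a ≤ b) (hbc : b ≤ c)
    {e₁ e₂ : ℝ → E} (h₁ : IsRightSolution v a b e₁) (h₂ : IsRightSolution v b c e₂)
    (hb : e₂ b = e₁ b) : ∃ e, e a = e₁ a ∧ e c = e₂ c ∧ IsRightSolution v a c e := by
  classical
  set e : ℝ → E := fun t => if t ≤ b then e₁ t else e₂ t with he
  have hl : ∀ t, t ≤ b → e t = e₁ t := fun t ht => if_pos ht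
  have hr : ∀ t, b ≤ t → e t = e₂ t := fun t ht => by
    rcases ht.eq_or_lt with rfl | ht
    · rw [hl _ le_rfl, hb]
    · exact if_neg ht.not_ge
  refine ⟨e, hl a hab, hr c hbc, ?_, fun t ht => ?_⟩
  · rw [← Icc_union_Icc_eq_Icc hab hbc]
    exact (h₁.1.congr fun t ht => hl t ht.2).union_of_isClosed
      (h₂.1.congr fun t ht => hr t ht.1) isClosed_Icc isClosed_Icc
  · rcases lt_or_ge t b with htb | htb
    · rw [hl t htb.le]
      refine (h₁.2 t ⟨ht.1, htb⟩).congr_of_eventuallyEq ?_ (hl t htb.le)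
      filter_upwards [mem_nhdsWithin_of_mem_nhds (Iio_mem_nhds htb)] with r hr' using hl r hr'.le
    · rw [hr t htb]
      exact (h₂.2 t ⟨htb, ht.2⟩).congr (fun r hr' => hr r (htb.trans hr')) (hr t htb)

theorem IsRightSolution.exists_of_chain {v : ℝ → E → E} {τ : ℕ → ℝ} (hτ : Monotone τ)
    (h : ∀ k x, ∃ e, e (τ k) = x ∧ IsRightSolution v (τ k) (τ (k + 1)) e) (n : ℕ) (x : E) :
    ∃ e, e (τ 0) = x ∧ IsRightSolution v (τ 0) (τ n) e := by
  induction n with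
  | zero =>
    obtain ⟨e, he, -⟩ := h 0 x
    exact ⟨e, he, by simp, by simp⟩
  | succ n ih =>
    obtain ⟨e₁, h₁, h₁'⟩ := ih
    obtain ⟨e₂, h₂, h₂'⟩ := h n (e₁ (τ n))
    obtain ⟨e, he, -, he'⟩ := h₁'.glue (hτ (Nat.zero_le n)) (hτ n.le_succ) h₂' h₂
    exact ⟨e, he.trans h₁, he'⟩

theorem IsRightSolution.mono {v : ℝ → E → E} {a c c' : ℝ} {e : ℝ → E}
    (h : IsRightSolution v a c e) (hc : c' ≤ c) : IsRightSolution v a c' e :=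
  ⟨h.1.mono (Icc_subset_Icc_right hc), fun t ht => h.2 t ⟨ht.1, ht.2.trans_le hc⟩⟩

theorem IsRightSolution.congr_field {v w : ℝ → E → E} {a c : ℝ} {e : ℝ → E}
    (h : IsRightSolution v a c e) (hvw : ∀ t ∈ Ico a c, v t = w t) : IsRightSolution w a c e :=
  ⟨h.1, fun t ht => hvw t ht ▸ h.2 t ht⟩

theorem exists_isRightSolution_linear_of_short [CompleteSpace E] {A : ℝ → E →L[ℝ] E} {b : ℝ → E}
    (hA : Continuous A) (hb : Continuous b) {a c K B : ℝ} (hac : a ≤ c) (hK : 0 ≤ K) (hB : 0 ≤ B)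
    (hAK : ∀ t ∈ Icc a c, ‖A t‖ ≤ K) (hbB : ∀ t ∈ Icc a c, ‖b t‖ ≤ B) (hshort : K * (c - a) ≤ 1 / 2)
    (x : E) :
    ∃ e, e a = x ∧ IsRightSolution (fun t y => A t y + b t) a c e := by
  -- This radius solves `(‖x‖ + ρ) / 2 + B (c - a) = ρ`, which is the Picard–Lindelöf condition once
  -- `K (c - a) ≤ 1 / 2`.
  set ρ : ℝ := ‖x‖ + 2 * B * (c - a) with hρ
  have hca : 0 ≤ c - a := sub_nonneg.2 hac
  have hρ0 : 0 ≤ ρ := by positivity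
  have hPL : IsPicardLindelof (fun t y => A t y + b t) (tmin := a) (tmax := c)
      ⟨a, left_mem_Icc.2 hac⟩ x ⟨ρ, hρ0⟩ 0 ⟨K * (‖x‖ + ρ) + B, by positivity⟩ ⟨K, hK⟩ := by
    refine ⟨fun t ht => ?_, fun y _ => ?_, fun t ht y hy => ?_, ?_⟩
    · refine LipschitzOnWith.of_dist_le_mul fun y _ z _ => ?_
      rw [dist_add_right, dist_eq_norm, dist_eq_norm, ← map_sub]
      exact (A t).le_of_opNorm_le (hAK t ht) _
    · exact ((hA.clm_apply continuous_const).add hb).continuousOn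
    · have hy' : ‖y‖ ≤ ‖x‖ + ρ := by
        have h1 : ‖y - x‖ ≤ ρ := by rw [← dist_eq_norm]; exact hy
        linarith [norm_le_norm_add_norm_sub' y x]
      exact (norm_add_le _ _).trans (add_le_add (((A t).le_of_opNorm_le (hAK t ht) _).trans
        (by gcongr)) (hbB t ht))
    · simp only [sub_self, NNReal.coe_zero, sub_zero, max_eq_left hca]
      change (K * (‖x‖ + ρ) + B) * (c - a) ≤ ρ
      have h1 : K * (c - a) * (‖x‖ + ρ) ≤ 1 / 2 * (‖x‖ + ρ) := by gcongr
      nlinarith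
  obtain ⟨e, he, he'⟩ := hPL.exists_eq_forall_mem_Icc_hasDerivWithinAt₀
  refine ⟨e, he, fun t ht => (he' t ht).continuousWithinAt, fun t ht => ?_⟩
  refine (he' t ⟨ht.1, ht.2.le⟩).mono_of_mem_nhdsWithin ?_
  exact mem_of_superset (Icc_mem_nhdsGE ht.2) (Icc_subset_Icc_left ht.1)

/-- A linear equation with continuous coefficients is solvable on every compact interval. -/
theorem exists_isRightSolution_linear [CompleteSpace E] {A : ℝ → E →L[ℝ] E} {b : ℝ → E}
    (hA : Continuous A) (hb : Continuous b) {a c : ℝ} (hac : a ≤ c) (x : E) :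
    ∃ e, e a = x ∧ IsRightSolution (fun t y => A t y + b t) a c e := by
  obtain ⟨K, hK⟩ := (isCompact_Icc (a := a) (b := c)).exists_bound_of_continuousOn hA.continuousOn
  obtain ⟨B, hB⟩ := (isCompact_Icc (a := a) (b := c)).exists_bound_of_continuousOn hb.continuousOn
  have ha : a ∈ Icc a c := left_mem_Icc.2 hac
  have hK0 : 0 ≤ K := (norm_nonneg _).trans (hK a ha)
  have hB0 : 0 ≤ B := (norm_nonneg _).trans (hB a ha)
  obtain ⟨n, hn⟩ := exists_nat_gt (2 * K * (c - a))
  have hca : 0 ≤ c - a := sub_nonneg.2 hac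
  have hn0 : (0 : ℝ) < n := lt_of_le_of_lt (by positivity) hn
  set δ := (c - a) / n with hδ
  have hδ0 : 0 ≤ δ := by positivity
  have hnδ : n * δ = c - a := by rw [hδ]; field_simp
  -- Truncation at `c` keeps every interval of the infinite chain inside `[a, c]`, where the bounds
  -- `K` and `B` hold.
  set τ : ℕ → ℝ := fun k => min (a + k * δ) c with hτ
  have hτm : Monotone τ := fun i j hij => by
    simp only [hτ]
    gcongr
  have haτ : ∀ k, a ≤ τ k := fun k => le_min (by nlinarith [(k.cast_nonneg : (0 : ℝ) ≤ k)]) hac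
  have hτ0 : τ 0 = a := by simp [hτ, hac]
  have hτn : τ n = c := by simp [hτ, hnδ]
  have := IsRightSolution.exists_of_chain (v := fun t y => A t y + b t) hτm (fun k x => ?_) n x
  · rwa [hτ0, hτn] at this
  · have hsub : Icc (τ k) (τ (k + 1)) ⊆ Icc a c := Icc_subset_Icc (haτ k) (min_le_right _ _)
    refine exists_isRightSolution_linear_of_short hA hb (hτm k.le_succ) hK0 hB0
      (fun t ht => hK t (hsub ht)) (fun t ht => hB t (hsub ht)) ?_ x
    have h1 : τ (k + 1) - τ k ≤ δ := by
      simp only [hτ, Nat.cast_add, Nat.cast_one]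
      rw [sub_le_iff_le_add, ← min_add_add_left]
      exact min_le_min (by linarith) (by linarith)
    calc K * (τ (k + 1) - τ k) ≤ K * δ := by gcongr
      _ ≤ 1 / 2 := by
        rw [hδ, ← mul_div_assoc, div_le_iff₀ hn0]
        linarith

end LinearODE

/-! ### Partial derivatives of the field, its Taylor polynomial, and the scaled differences. -/

section Jets

variable {d : ℕ}

theorem EuclideanSpace.norm_le_card_mul {v : State d} {C : ℝ} (h : ∀ i, |v i| ≤ C) :
    ‖v‖ ≤ d * C := by
  have hv : v = ∑ i, v i • EuclideanSpace.single i (1 : ℝ) := by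
    simpa using ((EuclideanSpace.basisFun (Fin d) ℝ).sum_repr v).symm
  rw [hv]
  calc _ ≤ ∑ i, ‖v i • EuclideanSpace.single i (1 : ℝ)‖ := norm_sum_le _ _
    _ ≤ ∑ _i : Fin d, C := Finset.sum_le_sum fun i _ => by simpa [norm_smul] using h i
    _ = d * C := by simp

theorem EuclideanSpace.abs_apply_le (v : State d) (i : Fin d) : |v i| ≤ ‖v‖ :=
  PiLp.norm_apply_le v i

instance (N : ℕ) : Finite (DiffIndex d N) := by
  let φ : DiffIndex d N → Fin d × Fin (N + 1) × (Σ l : Fin (N + 1), (Fin l → Fin d)) :=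
    fun k => (k.j, ⟨k.m, by have := k.le; omega⟩, ⟨⟨k.l, by have := k.le; omega⟩, k.dir⟩)
  refine Finite.of_injective φ ?_
  rintro ⟨j, m, l, dir, h⟩ ⟨j', m', l', dir', h'⟩ hk
  simp only [φ, Prod.mk.injEq, Fin.mk.injEq, Sigma.mk.injEq] at hk
  obtain ⟨rfl, rfl, rfl, h4⟩ := hk
  simp only [heq_eq_eq] at h4
  subst h4
  rfl

noncomputable instance (N : ℕ) : Fintype (DiffIndex d N) := Fintype.ofFinite _

/-- The derivative `∂^l g_j / ∂y_{i₁} ⋯ ∂y_{i_l}` at a point of the extended phase space. -/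
noncomputable def stateDeriv (g : State d → ℝ → State d) (j : Fin d) (l : ℕ) (dir : Fin l → Fin d)
    (z : State d × ℝ) : ℝ :=
  iteratedFDeriv ℝ l (fun y : State d => g y z.2 j) z.1
    (fun r => EuclideanSpace.single (dir r) (1 : ℝ))

/-- The mixed partial derivatives, in time and in the state, of total order at most `N`. -/
noncomputable def jet {N : ℕ} (g : State d → ℝ → State d) (z : State d × ℝ) (k : DiffIndex d N) :
    ℝ :=
  iteratedDeriv k.m (fun σ => stateDeriv g k.j k.l k.dir (z.1, σ)) z.2

/-- The Taylor polynomial with the prescribed partial derivatives `u`. -/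
noncomputable def taylorField (N : ℕ) (u : DiffIndex d N → ℝ) (v : State d) (s : ℝ) : State d :=
  WithLp.toLp 2 fun j => ∑ l : Fin (N + 1), ∑ dir : Fin l → Fin d,
    ((l : ℕ).factorial : ℝ)⁻¹ * (∏ r, v (dir r)) *
      ∑ m : Fin (N + 1 - l), ((m : ℕ).factorial : ℝ)⁻¹ * (s ^ (m : ℕ) * u ⟨j, m, l, dir, by omega⟩)

variable {g : State d → ℝ → State d}

theorem contDiff_component (hg : ContDiff ℝ ∞ fun x : State d × ℝ => g x.1 x.2) (t : ℝ)
    (j : Fin d) : ContDiff ℝ ∞ fun y : State d => g y t j :=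
  contDiff_euclidean.1 (hg.comp (contDiff_id.prodMk contDiff_const)) j

/-- A further state derivative is the derivative of the previous one in its state variable, with the
time as a parameter, so joint smoothness in state and time survives the induction. -/
theorem contDiff_stateDeriv (hg : ContDiff ℝ ∞ fun x : State d × ℝ => g x.1 x.2) (j : Fin d)
    (l : ℕ) (dir : Fin l → Fin d) : ContDiff ℝ ∞ (stateDeriv g j l dir) := by
  induction l with
  | zero => exact contDiff_euclidean.1 hg j
  | succ l ih =>
    have h : stateDeriv g j (l + 1) dir = fun z : State d × ℝ =>
        fderiv ℝ (fun y => stateDeriv g j l (Fin.tail dir) (y, z.2)) z.1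
          (EuclideanSpace.single (dir 0) (1 : ℝ)) := by
      funext z
      exact DifferentiableAt.iteratedFDeriv_succ_apply_left'
        ((contDiff_component hg z.2 j).differentiable_iteratedFDeriv
          (by exact_mod_cast WithTop.coe_lt_top _) _)
    rw [h]
    exact ContDiff.fderiv_apply (m := ∞)
      (f := fun (z : State d × ℝ) y => stateDeriv g j l (Fin.tail dir) (y, z.2))
      ((ih _).comp (contDiff_snd.prodMk (contDiff_snd.comp contDiff_fst)))
      contDiff_fst contDiff_const (by simp)

theorem contDiff_iteratedDeriv_snd {E : Type*} [NormedAddCommGroup E] [NormedSpace ℝ E]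
    {φ : E × ℝ → ℝ} (hφ : ContDiff ℝ ∞ φ) (m : ℕ) :
    ContDiff ℝ ∞ fun z : E × ℝ => iteratedDeriv m (fun σ => φ (z.1, σ)) z.2 := by
  induction m with
  | zero => simpa using hφ
  | succ m ih =>
    simp only [iteratedDeriv_succ, ← fderiv_apply_one_eq_deriv]
    exact ContDiff.fderiv_apply (m := ∞)
      (f := fun (z : E × ℝ) τ => iteratedDeriv m (fun σ => φ (z.1, σ)) τ)
      (ih.comp ((contDiff_fst.comp contDiff_fst).prodMk contDiff_snd))
      contDiff_snd contDiff_const (by simp)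

theorem contDiff_jet (hg : ContDiff ℝ ∞ fun x : State d × ℝ => g x.1 x.2) (N : ℕ) :
    ContDiff ℝ ∞ (jet (N := N) g) :=
  contDiff_pi.2 fun k => contDiff_iteratedDeriv_snd (contDiff_stateDeriv hg k.j k.l k.dir) k.m

theorem contDiff_slice {E : Type*} [NormedAddCommGroup E] [NormedSpace ℝ E] {φ : E × ℝ → ℝ}
    (hφ : ContDiff ℝ ∞ φ) (x : E) : ContDiff ℝ ∞ fun σ => φ (x, σ) :=
  hφ.comp (contDiff_const.prodMk contDiff_id)

theorem iteratedFDeriv_apply_eq_sum_stateDeriv (j : Fin d) (l : ℕ) (z : State d × ℝ)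
    (v : State d) :
    iteratedFDeriv ℝ l (fun y : State d => g y z.2 j) z.1 (fun _ => v)
      = ∑ dir : Fin l → Fin d, (∏ r, v (dir r)) * stateDeriv g j l dir z := by
  have hv : v = ∑ i, v i • EuclideanSpace.single i (1 : ℝ) := by
    simpa using ((EuclideanSpace.basisFun (Fin d) ℝ).sum_repr v).symm
  conv_lhs => rw [hv]
  rw [ContinuousMultilinearMap.map_sum]
  refine Finset.sum_congr rfl fun dir _ => ?_
  rw [ContinuousMultilinearMap.map_smul_univ]
  rfl

/-- Expand in the state at the shifted time up to degree `N`, then expand the coefficient of degree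
`l` in time up to degree `N - l`. Its time remainder is `O(η^(N+1-l))`, and the factor of size `η^l`
from the state directions restores the full order. -/
theorem exists_norm_sub_taylorField_le (hg : ContDiff ℝ ∞ fun x : State d × ℝ => g x.1 x.2)
    (N : ℕ) (R : ℝ) :
    ∃ C, 0 ≤ C ∧ ∀ (z : State d × ℝ) (v : State d) (s η : ℝ), ‖z‖ ≤ R → ‖v‖ ≤ η → |s| ≤ η →
      η ≤ R → ‖g (z.1 + v) (z.2 + s) - taylorField N (jet g z) v s‖ ≤ C * η ^ (N + 1) := by
  -- The remainders involve derivatives of order `N + 1` at points displaced by at most `η ≤ R`,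
  -- hence the radius `2 * R`.
  obtain ⟨M, hM0, hM⟩ :=
    (contDiff_jet hg (N + 1)).continuous.exists_norm_le_of_norm_le (2 * R)
  set C := (∑ _dir : Fin (N + 1) → Fin d, M) + ∑ l : Fin (N + 1), ∑ _dir : Fin l → Fin d, M with hC
  refine ⟨d * C, by positivity, fun z v s η hz hv hs hη => ?_⟩
  have hη0 : 0 ≤ η := (norm_nonneg v).trans hv
  rw [mul_assoc]
  refine EuclideanSpace.norm_le_card_mul fun j => ?_
  have hz1 : ‖z.1‖ ≤ R := (norm_fst_le z).trans hz
  have hz2 : |z.2| ≤ R := (norm_snd_le z).trans hz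
  have hprod : ∀ (l : ℕ) (dir : Fin l → Fin d), |∏ r, v (dir r)| ≤ η ^ l := fun l dir => by
    rw [Finset.abs_prod]
    calc _ ≤ ∏ _r : Fin l, η := Finset.prod_le_prod (fun _ _ => abs_nonneg _)
          fun r _ => (EuclideanSpace.abs_apply_le v _).trans hv
      _ = η ^ l := by simp
  have hjet : ∀ (w : State d × ℝ) (k : DiffIndex d (N + 1)), ‖w.1‖ ≤ 2 * R → |w.2| ≤ 2 * R →
      |jet g w k| ≤ M := fun w k h1 h2 =>
    (norm_le_pi_norm (jet g w) k).trans (hM w (max_le h1 h2))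
  have h1 := norm_sub_sum_iteratedFDeriv_le (contDiff_component hg (z.2 + s) j) N z.1 v
    (B := (∑ _dir : Fin (N + 1) → Fin d, M) * η ^ (N + 1)) (fun r hr => by
      rw [iteratedFDeriv_apply_eq_sum_stateDeriv j (N + 1) (z.1 + r • v, z.2 + s) v, Finset.sum_mul]
      refine (Finset.abs_sum_le_sum_abs _ _).trans (Finset.sum_le_sum fun dir _ => ?_)
      rw [abs_mul, mul_comm M]
      gcongr
      · exact hprod _ dir
      · have h := hjet (z.1 + r • v, z.2 + s) ⟨j, 0, N + 1, dir, by simp⟩ ?_ ?_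
        · simpa [jet] using h
        · have : ‖r • v‖ ≤ 1 * η := by
            rw [norm_smul, Real.norm_eq_abs, abs_of_nonneg hr.1]
            gcongr
            exact hr.2
          linarith [norm_add_le z.1 (r • v)]
        · linarith [abs_add_le z.2 s])
  rw [Finset.sum_range] at h1
  have h2 : ∀ (l : Fin (N + 1)) (dir : Fin l → Fin d),
      |stateDeriv g j l dir (z.1, z.2 + s) - ∑ m : Fin (N + 1 - l),
        ((m : ℕ).factorial : ℝ)⁻¹ * (s ^ (m : ℕ) * jet g z (⟨j, m, l, dir, by omega⟩ : DiffIndex d N))|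
        ≤ η ^ (N + 1 - l : ℕ) * M := by
    intro l dir
    obtain ⟨n, hn⟩ : ∃ n, N + 1 - (l : ℕ) = n + 1 := ⟨N - l, by omega⟩
    have hpow : ∀ (k : ℕ) (τ : ℝ), iteratedFDeriv ℝ k (fun σ => stateDeriv g j l dir (z.1, σ)) τ
        (fun _ => s) = s ^ k * iteratedDeriv k (fun σ => stateDeriv g j l dir (z.1, σ)) τ := by
      intro k τ
      have := (iteratedFDeriv ℝ k (fun σ => stateDeriv g j l dir (z.1, σ)) τ).map_smul_univ
        (fun _ => s) (fun _ => (1 : ℝ))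
      rw [iteratedDeriv_eq_iteratedFDeriv]
      simpa using this
    have h := norm_sub_sum_iteratedFDeriv_le
      (contDiff_slice (contDiff_stateDeriv hg j l dir) z.1) n z.2 s
      (B := η ^ (n + 1) * M) (fun r hr => by
        rw [hpow, abs_mul, abs_pow]
        gcongr
        refine hjet (z.1, z.2 + r • s) ⟨j, n + 1, l, dir, by omega⟩ (by simp; linarith) ?_
        have : |r • s| ≤ 1 * η := by
          rw [smul_eq_mul, abs_mul, abs_of_nonneg hr.1]
          gcongr
          exact hr.2
        simp only
        linarith [abs_add_le z.2 (r • s)])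
    simp only [hpow] at h
    rw [← hn, Finset.sum_range] at h
    exact h
  have h3 : |(∑ l : Fin (N + 1), ((l : ℕ).factorial : ℝ)⁻¹ *
        iteratedFDeriv ℝ l (fun y : State d => g y (z.2 + s) j) z.1 (fun _ => v))
      - taylorField N (jet g z) v s j| ≤
      (∑ l : Fin (N + 1), ∑ _dir : Fin l → Fin d, M) * η ^ (N + 1) := by
    rw [taylorField, PiLp.toLp_apply, ← Finset.sum_sub_distrib, Finset.sum_mul]
    refine (Finset.abs_sum_le_sum_abs _ _).trans (Finset.sum_le_sum fun l _ => ?_)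
    rw [iteratedFDeriv_apply_eq_sum_stateDeriv j l (z.1, z.2 + s) v, Finset.mul_sum,
      ← Finset.sum_sub_distrib, Finset.sum_mul]
    refine (Finset.abs_sum_le_sum_abs _ _).trans (Finset.sum_le_sum fun dir _ => ?_)
    rw [← mul_assoc, ← mul_sub, abs_mul, abs_mul, abs_of_nonneg (by positivity)]
    have hf : (((l : ℕ).factorial : ℝ))⁻¹ ≤ 1 :=
      inv_le_one_of_one_le₀ (by exact_mod_cast (l : ℕ).factorial_pos)
    calc _ ≤ 1 * η ^ (l : ℕ) * (η ^ (N + 1 - l : ℕ) * M) := by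
          gcongr
          · exact hprod _ dir
          · exact h2 l dir
      _ = M * η ^ (N + 1) := by
          rw [one_mul, ← mul_assoc, ← pow_add, Nat.add_sub_cancel' (by omega), mul_comm]
  rw [hC, add_mul]
  rw [PiLp.sub_apply]
  exact (abs_sub_le _ _ _).trans (add_le_add h1 h3)

/-- Each scaled difference is the corresponding partial derivative at a time shifted by at most `N *
h`, and the partial derivatives are Lipschitz on balls. -/
theorem exists_norm_scaledDiff_sub_jet_le (hg : ContDiff ℝ ∞ fun x : State d × ℝ => g x.1 x.2)
    (N : ℕ) (R : ℝ) :
    ∃ C, 0 ≤ C ∧ ∀ (z : State d × ℝ) (h : ℝ), ‖z‖ ≤ R → 0 < h → h ≤ 1 →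
      ‖scaledDiff (N := N) g (fun t => t) h z.2 z.1 - jet g z‖ ≤ C * h := by
  obtain ⟨C, hC0, hC⟩ := ((contDiff_jet hg N).of_le (m := 1)
    (by exact_mod_cast le_top)).exists_norm_sub_le_of_norm_le (R + N)
  refine ⟨C * N, by positivity, fun z h hz hh hh1 => ?_⟩
  refine (pi_norm_le_iff_of_nonneg (by positivity)).2 fun k => ?_
  obtain ⟨ξ, hξ, hξ'⟩ := fwdDiff_iterate_eq_iteratedDeriv hh k.m
    (contDiff_slice (contDiff_stateDeriv hg k.j k.l k.dir) z.1) z.2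
  have hkey : scaledDiff (N := N) g (fun t => t) h z.2 z.1 k = jet g (z.1, ξ) k := by
    change (h ^ k.m)⁻¹ * (fwdDiff h)^[k.m] (fun σ => stateDeriv g k.j k.l k.dir (z.1, σ)) z.2 = _
    rw [hξ', inv_mul_cancel_left₀ (by positivity)]
    rfl
  have hkN : (k.m : ℝ) ≤ N := by exact_mod_cast (Nat.le_add_left _ _).trans k.le
  have hd : |ξ - z.2| ≤ N * h := by
    rw [abs_of_nonneg (by linarith [hξ.1])]
    have : (k.m : ℝ) * h ≤ N * h := by gcongr
    linarith [hξ.2]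
  have hz2 : |z.2| ≤ R := (norm_snd_le z).trans hz
  have hNh : (N : ℝ) * h ≤ N := mul_le_of_le_one_right (by positivity) hh1
  have h1 := hC (z.1, ξ) z
    (max_le ((norm_fst_le z).trans (hz.trans (by linarith [(N.cast_nonneg : (0 : ℝ) ≤ N)])))
      (by rw [Real.norm_eq_abs]; linarith [abs_sub_abs_le_abs_sub ξ z.2]))
    (hz.trans (by linarith [(N.cast_nonneg : (0 : ℝ) ≤ N)]))
  have h2 : ‖(z.1, ξ) - z‖ ≤ N * h := max_le (by simp; positivity) hd
  rw [Pi.sub_apply, hkey, ← Pi.sub_apply]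
  refine (norm_le_pi_norm (jet g (z.1, ξ) - jet g z) k).trans (h1.trans ?_)
  rw [mul_assoc]
  gcongr

end Jets

/-! ### Polynomial dependence on the jet and on the step size. -/

section PolynomialFamilies

/-- `F u h` is a polynomial in `h` and in the coordinates of `u`. -/
def IsPolynomialFamily {ι : Type*} (F : (ι → ℝ) → ℝ → ℝ) : Prop :=
  ∃ Q : Polynomial (MvPolynomial ι ℝ), ∀ u h, F u h = Q.eval₂ (MvPolynomial.eval u) h

namespace IsPolynomialFamily

variable {ι : Type*} {F G : (ι → ℝ) → ℝ → ℝ}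

theorem const (c : ℝ) : IsPolynomialFamily fun (_ : ι → ℝ) _ => c :=
  ⟨Polynomial.C (MvPolynomial.C c), by simp⟩

theorem coord (k : ι) : IsPolynomialFamily fun (u : ι → ℝ) _ => u k :=
  ⟨Polynomial.C (MvPolynomial.X k), by simp⟩

theorem var : IsPolynomialFamily fun (_ : ι → ℝ) h => h :=
  ⟨Polynomial.X, by simp⟩

theorem add (hF : IsPolynomialFamily F) (hG : IsPolynomialFamily G) :
    IsPolynomialFamily fun u h => F u h + G u h := by
  obtain ⟨P, hP⟩ := hF
  obtain ⟨Q, hQ⟩ := hG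
  exact ⟨P + Q, fun u h => by simp only [Polynomial.eval₂_add, hP, hQ]⟩

theorem mul (hF : IsPolynomialFamily F) (hG : IsPolynomialFamily G) :
    IsPolynomialFamily fun u h => F u h * G u h := by
  obtain ⟨P, hP⟩ := hF
  obtain ⟨Q, hQ⟩ := hG
  exact ⟨P * Q, fun u h => by simp only [Polynomial.eval₂_mul, hP, hQ]⟩

theorem sub (hF : IsPolynomialFamily F) (hG : IsPolynomialFamily G) :
    IsPolynomialFamily fun u h => F u h - G u h := by
  simpa [sub_eq_add_neg] using hF.add ((const (-1)).mul hG)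

theorem sum {α : Type*} (s : Finset α) {H : α → (ι → ℝ) → ℝ → ℝ}
    (hH : ∀ a ∈ s, IsPolynomialFamily (H a)) : IsPolynomialFamily fun u h => ∑ a ∈ s, H a u h := by
  classical
  induction s using Finset.induction_on with
  | empty => simpa using const (ι := ι) 0
  | insert a s ha ih =>
    simp only [Finset.sum_insert ha]
    exact (hH a (by simp)).add (ih fun b hb => hH b (by simp [hb]))

theorem prod {α : Type*} (s : Finset α) {H : α → (ι → ℝ) → ℝ → ℝ}
    (hH : ∀ a ∈ s, IsPolynomialFamily (H a)) : IsPolynomialFamily fun u h => ∏ a ∈ s, H a u h := by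
  classical
  induction s using Finset.induction_on with
  | empty => simpa using const (ι := ι) 1
  | insert a s ha ih =>
    simp only [Finset.prod_insert ha]
    exact (hH a (by simp)).mul (ih fun b hb => hH b (by simp [hb]))

theorem pow (hF : IsPolynomialFamily F) (n : ℕ) : IsPolynomialFamily fun u h => F u h ^ n := by
  obtain ⟨P, hP⟩ := hF
  exact ⟨P ^ n, fun u h => by simp only [Polynomial.eval₂_pow, hP]⟩

theorem continuous (hF : IsPolynomialFamily F) :
    Continuous fun x : (ι → ℝ) × ℝ => F x.1 x.2 := by
  obtain ⟨P, hP⟩ := hF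
  simp only [hP, Polynomial.eval₂_eq_sum_range]
  exact continuous_finsetSum _ fun i _ =>
    ((MvPolynomial.continuous_eval _).comp continuous_fst).mul (continuous_snd.pow i)

/-- Closure under integration in `h` is what makes Picard iterates polynomial. -/
theorem integral (hF : IsPolynomialFamily F) :
    IsPolynomialFamily fun u h => ∫ s in (0 : ℝ)..h, F u s := by
  obtain ⟨P, hP⟩ := hF
  have : ∀ (u : ι → ℝ) (h : ℝ), ∫ s in (0 : ℝ)..h, F u s =
      ∑ i ∈ Finset.range (P.natDegree + 1),
        MvPolynomial.eval u (P.coeff i) * ((i + 1 : ℝ)⁻¹ * h ^ (i + 1)) := by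
    intro u h
    simp only [hP, Polynomial.eval₂_eq_sum_range]
    rw [intervalIntegral.integral_finsetSum fun i _ =>
      (show Continuous fun s : ℝ => MvPolynomial.eval u (P.coeff i) * s ^ i by
        fun_prop).intervalIntegrable _ _]
    refine Finset.sum_congr rfl fun i _ => ?_
    rw [intervalIntegral.integral_const_mul, integral_pow]
    simp [div_eq_inv_mul]
  simp only [this]
  exact sum _ fun i _ => mul ⟨Polynomial.C (P.coeff i), by simp⟩ ((const _).mul (var.pow _))

end IsPolynomialFamily

end PolynomialFamilies

/-! ### The Taylor field and its Picard iterates. -/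

section TaylorField

attribute [local irreducible] taylorField

variable {d N : ℕ}

theorem taylorField_apply (u : DiffIndex d N → ℝ) (v : State d) (s : ℝ) (j : Fin d) :
    taylorField N u v s j = ∑ l : Fin (N + 1), ∑ dir : Fin l → Fin d,
      ((l : ℕ).factorial : ℝ)⁻¹ * (∏ r, v (dir r)) * ∑ m : Fin (N + 1 - l),
        ((m : ℕ).factorial : ℝ)⁻¹ * (s ^ (m : ℕ) * u ⟨j, m, l, dir, by omega⟩) := by
  rw [taylorField]

theorem taylorField_zero (v : State d) (s : ℝ) :
    taylorField N (fun _ : DiffIndex d N => 0) v s = 0 := by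
  ext j
  simp [taylorField_apply]

theorem contDiff_taylorField :
    ContDiff ℝ ∞ fun x : (DiffIndex d N → ℝ) × State d × ℝ => taylorField N x.1 x.2.1 x.2.2 := by
  refine contDiff_euclidean.2 fun j => ?_
  simp only [taylorField_apply]
  refine ContDiff.sum fun l _ => ContDiff.sum fun dir _ => ?_
  refine (contDiff_const.mul (contDiff_prod fun r _ => ?_)).mul (ContDiff.sum fun m _ => ?_)
  · exact contDiff_euclidean.1 (contDiff_fst.comp contDiff_snd) (dir r)
  · exact contDiff_const.mul (((contDiff_snd.comp contDiff_snd).pow _).mul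
      ((contDiff_apply ℝ ℝ _).comp contDiff_fst))

theorem IsPolynomialFamily.taylorField {V : (DiffIndex d N → ℝ) → ℝ → State d}
    {σ : (DiffIndex d N → ℝ) → ℝ → ℝ} (hV : ∀ j, IsPolynomialFamily fun u h => V u h j)
    (hσ : IsPolynomialFamily σ) (j : Fin d) :
    IsPolynomialFamily fun u h => taylorField N u (V u h) (σ u h) j := by
  simp only [taylorField_apply]
  exact sum _ fun l _ => sum _ fun dir _ => ((const _).mul (prod _ fun r _ => hV _)).mul
    (sum _ fun m _ => (const _).mul ((hσ.pow _).mul (coord _)))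

/-- The Picard iterates of the initial value problem `ẏ = taylorField N u y t`, `y(0) = 0`. -/
noncomputable def taylorPicard (N : ℕ) (u : DiffIndex d N → ℝ) : ℕ → ℝ → State d
  | 0, _ => 0
  | n + 1, h => ∫ s in (0 : ℝ)..h, taylorField N u (taylorPicard N u n s) s

theorem isPolynomialFamily_taylorPicard (n : ℕ) (j : Fin d) :
    IsPolynomialFamily fun u h => taylorPicard N u n h j := by
  induction n generalizing j with
  | zero => simpa [taylorPicard] using IsPolynomialFamily.const 0
  | succ n ih =>
    have hp : ∀ i, IsPolynomialFamily fun u s => taylorField N u (taylorPicard N u n s) s i :=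
      IsPolynomialFamily.taylorField (V := fun u s => taylorPicard N u n s) (σ := fun _ s => s)
        ih IsPolynomialFamily.var
    have : ∀ u h, taylorPicard N u (n + 1) h j
        = ∫ s in (0 : ℝ)..h, taylorField N u (taylorPicard N u n s) s j := by
      intro u h
      have hc : Continuous fun s => taylorField N u (taylorPicard N u n s) s := by
        refine (PiLp.continuous_toLp 2 _).comp (continuous_pi fun i => ?_)
        exact (hp i).continuous.comp (continuous_const.prodMk continuous_id)
      exact ((EuclideanSpace.proj (𝕜 := ℝ) j).intervalIntegral_comp_comm
        (hc.intervalIntegrable 0 h)).symm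
    simp only [this]
    exact (hp j).integral

theorem continuous_of_components {X : Type*} [TopologicalSpace X] {φ : X → State d}
    (h : ∀ j, Continuous fun x => φ x j) : Continuous φ :=
  (PiLp.continuous_toLp 2 _).comp (continuous_pi h)

theorem continuous_taylorPicard (n : ℕ) :
    Continuous fun x : (DiffIndex d N → ℝ) × ℝ => taylorPicard N x.1 n x.2 :=
  continuous_of_components fun j => (isPolynomialFamily_taylorPicard n j).continuous

theorem hasDerivAt_taylorPicard (u : DiffIndex d N → ℝ) (n : ℕ) (h : ℝ) :
    HasDerivAt (taylorPicard N u (n + 1)) (taylorField N u (taylorPicard N u n h) h) h := by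
  have hc : Continuous fun s => taylorField N u (taylorPicard N u n s) s :=
    contDiff_taylorField.continuous.comp (continuous_const.prodMk
      (((continuous_taylorPicard n).comp (continuous_const.prodMk continuous_id)).prodMk
        continuous_id))
  exact (hc.integral_hasStrictDerivAt 0 h).hasDerivAt

theorem taylorPicard_apply_zero (u : DiffIndex d N → ℝ) (n : ℕ) : taylorPicard N u n 0 = 0 := by
  cases n <;> simp [taylorPicard]

theorem taylorPicard_zero (n : ℕ) (h : ℝ) :
    taylorPicard N (fun _ : DiffIndex d N => 0) n h = 0 := by
  cases n <;> simp [taylorPicard, taylorField_zero]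

end TaylorField

/-! ### Reduction to a time-dependent field; smooth and polynomial dependence of the stages. -/

namespace RKScheme

variable {s d N : ℕ} (S : RKScheme s)

/-- The control enters only through `f x (θ τ)`, so the scheme can be studied for a plain
time-dependent field. The companion lemmas pass this on to the numerical solution. -/
theorem stage_comp {W : Type*} (f : State d → W → State d) (θ : ℝ → W) (h t : ℝ) (y : State d)
    (i : Fin s) :
    S.stage (fun x τ => f x (θ τ)) (fun τ => τ) h t y i = S.stage f θ h t y i := by
  induction i using WellFoundedLT.induction with
  | ind i ih =>
    rw [stage, stage]
    congr 4
    funext j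
    rw [ih _ (show _ < i from j.isLt)]

theorem increment_comp {W : Type*} (f : State d → W → State d) (θ : ℝ → W) (h t : ℝ)
    (y : State d) :
    S.increment (fun x τ => f x (θ τ)) (fun τ => τ) h t y = S.increment f θ h t y := by
  simp only [increment, stage_comp]

theorem node_comp {W : Type*} (f : State d → W → State d) (θ : ℝ → W) (y₀ : State d) (h : ℝ)
    (n : ℕ) : S.node (fun x τ => f x (θ τ)) (fun τ => τ) y₀ h n = S.node f θ y₀ h n := by
  induction n with
  | zero => rfl
  | succ n ih => rw [node, node, ih, increment_comp]

theorem approx_comp {W : Type*} (f : State d → W → State d) (θ : ℝ → W) (y₀ : State d) (h : ℝ) :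
    S.approx (fun x τ => f x (θ τ)) (fun τ => τ) y₀ h = S.approx f θ y₀ h := by
  funext t
  simp only [approx, node_comp]

/-- The parameter space `Z` will hold the jet of a Taylor field, which yields bounds uniform over
bounded jets. -/
theorem contDiff_stage {Z : Type*} [NormedAddCommGroup Z] [NormedSpace ℝ Z]
    {F : Z → State d → ℝ → State d}
    (hF : ContDiff ℝ ∞ fun x : Z × State d × ℝ => F x.1 x.2.1 x.2.2) (i : Fin s) :
    ContDiff ℝ ∞ fun x : Z × ℝ × ℝ × State d =>
      S.stage (F x.1) (fun t => t) x.2.1 x.2.2.1 x.2.2.2 i := by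
  induction i using WellFoundedLT.induction with
  | ind i ih =>
    have hh : ContDiff ℝ ∞ fun x : Z × ℝ × ℝ × State d => x.2.1 := contDiff_fst.comp contDiff_snd
    have ht : ContDiff ℝ ∞ fun x : Z × ℝ × ℝ × State d => x.2.2.1 :=
      contDiff_fst.comp (contDiff_snd.comp contDiff_snd)
    have hy : ContDiff ℝ ∞ fun x : Z × ℝ × ℝ × State d => x.2.2.2 :=
      contDiff_snd.comp (contDiff_snd.comp contDiff_snd)
    have hk := ContDiff.sum (s := Finset.univ) fun (j : Fin i.val) _ =>
      (ih ⟨j.val, j.isLt.trans i.isLt⟩ j.isLt).const_smul (S.a i ⟨j.val, j.isLt.trans i.isLt⟩)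
    have hc : ContDiff ℝ ∞ fun x : Z × ℝ × ℝ × State d => S.c i * x.2.1 := contDiff_const.mul hh
    convert hF.comp (contDiff_fst.prodMk ((hy.add (hh.smul hk)).prodMk (ht.add hc))) using 2 with x
    rw [stage]
    rfl

theorem contDiff_increment {Z : Type*} [NormedAddCommGroup Z] [NormedSpace ℝ Z]
    {F : Z → State d → ℝ → State d}
    (hF : ContDiff ℝ ∞ fun x : Z × State d × ℝ => F x.1 x.2.1 x.2.2) :
    ContDiff ℝ ∞ fun x : Z × ℝ × ℝ × State d =>
      S.increment (F x.1) (fun t => t) x.2.1 x.2.2.1 x.2.2.2 :=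
  ContDiff.sum fun i _ => (S.contDiff_stage hF i).const_smul _

/-- By explicitness, a stage is a finite composition of Taylor fields and linear combinations. -/
theorem isPolynomialFamily_stage (i : Fin s) (j : Fin d) :
    IsPolynomialFamily fun u h => S.stage (taylorField N u) (fun t => t) h 0 0 i j := by
  induction i using WellFoundedLT.induction generalizing j with
  | ind i ih =>
    have hV : ∀ r : Fin d, IsPolynomialFamily fun (u : DiffIndex d N → ℝ) h =>
        ((0 : State d) + h • ∑ j : Fin i.val, S.a i ⟨j.val, j.isLt.trans i.isLt⟩ •
          S.stage (taylorField N u) (fun t => t) h 0 0 ⟨j.val, j.isLt.trans i.isLt⟩) r := by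
      intro r
      have := IsPolynomialFamily.var.mul (IsPolynomialFamily.sum Finset.univ fun (j : Fin i.val) _ =>
        (IsPolynomialFamily.const (S.a i ⟨j.val, j.isLt.trans i.isLt⟩)).mul
          (ih ⟨j.val, j.isLt.trans i.isLt⟩ j.isLt r))
      simpa using this
    have := IsPolynomialFamily.taylorField hV
      ((IsPolynomialFamily.const 0).add ((IsPolynomialFamily.const (S.c i)).mul
        IsPolynomialFamily.var)) j
    convert this using 3 with u h
    rw [stage]

theorem stage_taylorField_zero (h t : ℝ) (y : State d) (i : Fin s) :
    S.stage (taylorField N fun _ : DiffIndex d N => 0) (fun t => t) h t y i = 0 := by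
  rw [stage, taylorField_zero]

end RKScheme

/-- Powers of `X` are divided out one at a time: while the quotient is still `O(h^k)` with `k ≥ 1`,
it tends to `0`, so its constant coefficient vanishes. -/
theorem Polynomial.coeff_eq_zero_of_isBigO {Q : Polynomial ℝ} {p : ℕ}
    (hQ : (fun h : ℝ => Q.eval h) =O[𝓝[>] (0 : ℝ)] fun h : ℝ => h ^ (p + 1)) :
    ∀ k ≤ p, Q.coeff k = 0 := by
  have hdvd : ∀ k ≤ p + 1, (Polynomial.X : Polynomial ℝ) ^ k ∣ Q := by
    intro k
    induction k with
    | zero => simp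
    | succ k ih =>
      intro hk
      obtain ⟨R, rfl⟩ := ih (by omega)
      have hR : (fun h : ℝ => R.eval h) =O[𝓝[>] (0 : ℝ)] fun h : ℝ => h ^ (p + 1 - k) := by
        have h1 := (Asymptotics.isBigO_refl (fun h : ℝ => (h ^ k)⁻¹) (𝓝[>] (0 : ℝ))).mul hQ
        refine (h1.congr' ?_ ?_)
        · filter_upwards [self_mem_nhdsWithin] with h hh
          have : h ^ k ≠ 0 := pow_ne_zero _ (ne_of_gt hh)
          simp [this]
        · filter_upwards [self_mem_nhdsWithin] with h hh
          have : h ^ k ≠ 0 := pow_ne_zero _ (ne_of_gt hh)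
          rw [show p + 1 = k + (p + 1 - k) by omega, pow_add, inv_mul_cancel_left₀ this]
          congr 1
          omega
      have h0 : Tendsto (fun h : ℝ => h ^ (p + 1 - k)) (𝓝[>] 0) (𝓝 0) := by
        have : Tendsto (fun h : ℝ => h ^ (p + 1 - k)) (𝓝 0) (𝓝 (0 ^ (p + 1 - k))) :=
          (continuous_pow _).tendsto 0
        rw [zero_pow (by omega)] at this
        exact this.mono_left nhdsWithin_le_nhds
      have h1 : Tendsto (fun h : ℝ => R.eval h) (𝓝[>] 0) (𝓝 (R.eval 0)) :=
        (R.continuous.tendsto 0).mono_left nhdsWithin_le_nhds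
      have h2 : R.eval 0 = 0 := tendsto_nhds_unique h1 (hR.trans_tendsto h0)
      rw [pow_succ]
      refine mul_dvd_mul_left _ (Polynomial.X_dvd_iff.2 ?_)
      rwa [Polynomial.coeff_zero_eq_eval_zero]
  exact fun k hk => Polynomial.X_pow_dvd_iff.1 (hdvd (p + 1) le_rfl) k (by omega)

theorem Polynomial.exists_abs_eval₂_sub_le {ι : Type*} [Fintype ι]
    (Q : Polynomial (MvPolynomial ι ℝ)) (n : ℕ) (M : ℝ) :
    ∃ C, 0 ≤ C ∧ ∀ (u : ι → ℝ) (h : ℝ), ‖u‖ ≤ M → 0 ≤ h → h ≤ 1 →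
      (∀ k < n, MvPolynomial.eval u (Q.coeff k) = 0) →
      |Q.eval₂ (MvPolynomial.eval u) h - MvPolynomial.eval u (Q.coeff n) * h ^ n|
        ≤ C * h ^ (n + 1) := by
  have hB : ∀ i, ∃ B, 0 ≤ B ∧ ∀ u : ι → ℝ, ‖u‖ ≤ M → ‖MvPolynomial.eval u (Q.coeff i)‖ ≤ B :=
    fun i => (MvPolynomial.continuous_eval (Q.coeff i)).exists_norm_le_of_norm_le M
  choose B hB0 hB using hB
  refine ⟨∑ i ∈ Finset.range (Q.natDegree + 1 + (n + 1)), B i,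
    Finset.sum_nonneg fun i _ => hB0 i, fun u h hu hh hh1 hk => ?_⟩
  -- The summation range is enlarged so that it contains the index `n` even if `Q` has smaller
  -- degree.
  rw [Polynomial.eval₂_eq_sum_range' (n := Q.natDegree + 1 + (n + 1)) _ (by omega),
    ← Finset.sum_erase_eq_sub (Finset.mem_range.2 (by omega) : n ∈ Finset.range (Q.natDegree + 1 + (n + 1))),
    Finset.sum_mul]
  refine (Finset.abs_sum_le_sum_abs _ _).trans ((Finset.sum_le_sum fun i hi => ?_).trans
    (Finset.sum_le_sum_of_subset_of_nonneg (Finset.erase_subset n _)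
      fun i _ _ => mul_nonneg (hB0 i) (by positivity)))
  rcases lt_or_ge i n with hin | hin
  · rw [hk i hin, zero_mul, abs_zero]
    exact mul_nonneg (hB0 i) (by positivity)
  · have hin' : n + 1 ≤ i := by
      have := Finset.ne_of_mem_erase hi
      omega
    rw [abs_mul, abs_of_nonneg (pow_nonneg hh i)]
    exact mul_le_mul (hB i u hu) (pow_le_pow_of_le_one hh hh1 hin') (by positivity) (hB0 i)

/-! ### Replacing the field by its Taylor polynomial inside the scheme. -/

namespace RKScheme

variable {s d : ℕ} (S : RKScheme s) {g : State d → ℝ → State d}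

theorem contDiff_stage_of_field (hg : ContDiff ℝ ∞ fun x : State d × ℝ => g x.1 x.2)
    (i : Fin s) :
    ContDiff ℝ ∞ fun x : ℝ × ℝ × State d => S.stage g (fun t => t) x.1 x.2.1 x.2.2 i :=
  (S.contDiff_stage (Z := ℝ) (F := fun _ => g) (hg.comp contDiff_snd) i).comp
    ((contDiff_const (c := (0 : ℝ))).prodMk contDiff_id)

theorem contDiff_increment_of_field (hg : ContDiff ℝ ∞ fun x : State d × ℝ => g x.1 x.2) :
    ContDiff ℝ ∞ fun x : ℝ × ℝ × State d => S.increment g (fun t => t) x.1 x.2.1 x.2.2 :=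
  (S.contDiff_increment (Z := ℝ) (F := fun _ => g) (hg.comp contDiff_snd)).comp
    ((contDiff_const (c := (0 : ℝ))).prodMk contDiff_id)

/-- Two errors enter a stage: the Taylor remainder at a displacement of size `O(h)`, and the errors
of earlier stages, passed on by the Lipschitz bound of the Taylor field. Both are `O(h^(N+1))`. -/
theorem exists_norm_stage_sub_le (hg : ContDiff ℝ ∞ fun x : State d × ℝ => g x.1 x.2) (N : ℕ)
    (R : ℝ) (i : Fin s) :
    ∃ C, 0 ≤ C ∧ ∀ (z : State d × ℝ) (h : ℝ), ‖z‖ ≤ R → 0 ≤ h → h ≤ 1 →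
      ‖S.stage g (fun t => t) h z.2 z.1 i
        - S.stage (taylorField N (jet g z)) (fun t => t) h 0 0 i‖ ≤ C * h ^ (N + 1) := by
  induction i using WellFoundedLT.induction with
  | ind i ih =>
    let ρ : Fin i.val → Fin s := fun j => ⟨j.val, j.isLt.trans i.isLt⟩
    have ih' : ∀ j : Fin i.val, _ := fun j => ih (ρ j) j.isLt
    choose K hK0 hK using ih'
    obtain ⟨M, hM0, hM⟩ := (contDiff_jet hg N).continuous.exists_norm_le_of_norm_le R
    let W : ℝ × ℝ × State d → State d := fun x =>
      ∑ j, S.a i (ρ j) • S.stage g (fun t => t) x.1 x.2.1 x.2.2 (ρ j)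
    let W' : (DiffIndex d N → ℝ) × ℝ × ℝ × State d → State d := fun x =>
      ∑ j, S.a i (ρ j) • S.stage (taylorField N x.1) (fun t => t) x.2.1 x.2.2.1 x.2.2.2 (ρ j)
    have hW : Continuous W := continuous_finsetSum _ fun j _ =>
      (S.contDiff_stage_of_field hg (ρ j)).continuous.fun_const_smul _
    have hW' : Continuous W' := continuous_finsetSum _ fun j _ =>
      (S.contDiff_stage contDiff_taylorField (ρ j)).continuous.fun_const_smul _
    obtain ⟨B, hB0, hB⟩ := hW.exists_norm_le_of_norm_le (max 1 R)
    obtain ⟨B', hB0', hB'⟩ := hW'.exists_norm_le_of_norm_le (max 1 M)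
    obtain ⟨C₁, hC₁0, hC₁⟩ := exists_norm_sub_taylorField_le hg N (max R (B + |S.c i|))
    obtain ⟨L, hL0, hL⟩ := ((contDiff_taylorField (d := d) (N := N)).of_le (m := 1)
      (by exact_mod_cast le_top)).exists_norm_sub_le_of_norm_le (M + B + B' + |S.c i|)
    set A := ∑ j, |S.a i (ρ j)| * K j with hA
    have hA0 : 0 ≤ A := Finset.sum_nonneg fun j _ => mul_nonneg (abs_nonneg _) (hK0 j)
    refine ⟨C₁ * (B + |S.c i|) ^ (N + 1) + L * A, by positivity, fun z h hz hh hh1 => ?_⟩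
    have e1 : S.stage g (fun t => t) h z.2 z.1 i
        = g (z.1 + h • W (h, z.2, z.1)) (z.2 + S.c i * h) := by rw [stage]
    have e2 : S.stage (taylorField N (jet g z)) (fun t => t) h 0 0 i
        = taylorField N (jet g z) (h • W' (jet g z, h, 0, 0)) (S.c i * h) := by
      rw [stage, zero_add, zero_add]
    rw [e1, e2]
    have hz1 : ‖z.1‖ ≤ R := (norm_fst_le z).trans hz
    have hz2 : ‖z.2‖ ≤ R := (norm_snd_le z).trans hz
    have hhn : ‖h‖ ≤ 1 := by rwa [Real.norm_of_nonneg hh]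
    have hWb : ‖W (h, z.2, z.1)‖ ≤ B := hB _ (max_le (hhn.trans (le_max_left _ _))
      (max_le (hz2.trans (le_max_right _ _)) (hz1.trans (le_max_right _ _))))
    have hWb' : ‖W' (jet g z, h, 0, 0)‖ ≤ B' := hB' _ (max_le ((hM z hz).trans (le_max_right _ _))
      (max_le (hhn.trans (le_max_left _ _)) (by simp [Prod.norm_def])))
    have hwB : ‖h • W (h, z.2, z.1)‖ ≤ h * B := by
      rw [norm_smul, Real.norm_of_nonneg hh]; gcongr
    have hwB' : ‖h • W' (jet g z, h, 0, 0)‖ ≤ h * B' := by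
      rw [norm_smul, Real.norm_of_nonneg hh]; gcongr
    have hch : |S.c i * h| ≤ h * |S.c i| := by rw [abs_mul, abs_of_nonneg hh, mul_comm]
    have hdiff : ‖W (h, z.2, z.1) - W' (jet g z, h, 0, 0)‖ ≤ A * h ^ (N + 1) := by
      simp only [W, W', ← Finset.sum_sub_distrib, ← smul_sub, hA, Finset.sum_mul]
      refine (norm_sum_le _ _).trans (Finset.sum_le_sum fun j _ => ?_)
      rw [norm_smul, Real.norm_eq_abs, mul_assoc]
      gcongr
      exact hK j z h hz hh hh1
    have h1 := hC₁ z (h • W (h, z.2, z.1)) (S.c i * h) (h * (B + |S.c i|))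
      (hz.trans (le_max_left _ _))
      (hwB.trans (by gcongr; linarith [abs_nonneg (S.c i)])) (hch.trans (by gcongr; linarith))
      ((mul_le_of_le_one_left (by positivity) hh1).trans (le_max_right _ _))
    have hle : ∀ x : ℝ, 0 ≤ x → h * x ≤ x := fun x hx => mul_le_of_le_one_left hx hh1
    have hcn := abs_nonneg (S.c i)
    have h2 := hL (jet g z, h • W (h, z.2, z.1), S.c i * h)
      (jet g z, h • W' (jet g z, h, 0, 0), S.c i * h)
      (max_le (by linarith [hM z hz]) (max_le (by linarith [hle B hB0])
        (by rw [Real.norm_eq_abs]; linarith [hle _ hcn])))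
      (max_le (by linarith [hM z hz]) (max_le (by linarith [hle B' hB0'])
        (by rw [Real.norm_eq_abs]; linarith [hle _ hcn])))
    have h3 : ‖((jet g z, h • W (h, z.2, z.1), S.c i * h) :
          (DiffIndex d N → ℝ) × State d × ℝ) - (jet g z, h • W' (jet g z, h, 0, 0), S.c i * h)‖
        ≤ A * h ^ (N + 1) := by
      have : 0 ≤ A * h ^ (N + 1) := by positivity
      refine max_le (by simpa using this) (max_le ?_ (by simpa using this))
      change ‖h • W (h, z.2, z.1) - h • W' (jet g z, h, 0, 0)‖ ≤ _
      rw [← smul_sub, norm_smul, Real.norm_of_nonneg hh]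
      exact (mul_le_of_le_one_left (norm_nonneg _) hh1).trans hdiff
    calc _ ≤ _ + _ := norm_sub_le_norm_sub_add_norm_sub _ _ _
      _ ≤ C₁ * (h * (B + |S.c i|)) ^ (N + 1) + L * (A * h ^ (N + 1)) :=
        add_le_add h1 (h2.trans (by gcongr))
      _ = _ := by rw [mul_pow]; ring

theorem exists_norm_increment_sub_le (hg : ContDiff ℝ ∞ fun x : State d × ℝ => g x.1 x.2)
    (N : ℕ) (R : ℝ) :
    ∃ C, 0 ≤ C ∧ ∀ (z : State d × ℝ) (h : ℝ), ‖z‖ ≤ R → 0 ≤ h → h ≤ 1 →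
      ‖S.increment g (fun t => t) h z.2 z.1
        - S.increment (taylorField N (jet g z)) (fun t => t) h 0 0‖ ≤ C * h ^ (N + 1) := by
  choose K hK0 hK using S.exists_norm_stage_sub_le hg N R
  refine ⟨∑ i, |S.b i| * K i, Finset.sum_nonneg fun i _ => mul_nonneg (abs_nonneg _) (hK0 i),
    fun z h hz hh hh1 => ?_⟩
  simp only [increment, ← Finset.sum_sub_distrib, ← smul_sub, Finset.sum_mul]
  refine (norm_sum_le _ _).trans (Finset.sum_le_sum fun j _ => ?_)
  rw [norm_smul, Real.norm_eq_abs, mul_assoc]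
  gcongr
  exact hK j z h hz hh hh1

end RKScheme

/-! ### Comparison of the exact solution with Picard iterates. -/

section ExactSolution

variable {d : ℕ} {g : State d → ℝ → State d} {y : ℝ → State d} {T : ℝ}

theorem exists_norm_prod_le_of_continuousOn (hy : ContinuousOn y (Icc 0 T)) :
    ∃ R, 0 ≤ R ∧ ∀ t ∈ Icc (0 : ℝ) T, ‖(y t, t)‖ ≤ R := by
  obtain ⟨C, hC⟩ := isCompact_Icc.exists_bound_of_continuousOn (hy.prodMk continuousOn_id)
  exact ⟨max C 0, le_max_right _ _, fun t ht => (hC t ht).trans (le_max_left _ _)⟩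

theorem hasDerivWithinAt_shift
    (hy : ∀ t ∈ Icc (0 : ℝ) T, HasDerivWithinAt y (g (y t) t) (Icc 0 T) t) {t h : ℝ} (ht : 0 ≤ t)
    (hth : t + h ≤ T) {r : ℝ} (hr : r ∈ Icc 0 h) :
    HasDerivWithinAt (fun r => y (t + r)) (g (y (t + r)) (t + r)) (Icc 0 h) r := by
  have h1 := hy (t + r) ⟨add_nonneg ht hr.1, by linarith [hr.2]⟩
  have h2 : HasDerivWithinAt (fun r => t + r) 1 (Icc 0 h) r :=
    ((hasDerivAt_id r).const_add t).hasDerivWithinAt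
  have := h1.scomp r h2 fun x hx => ⟨add_nonneg ht hx.1, by linarith [hx.2]⟩
  rwa [one_smul] at this

/-- Each iteration gains one power of `h`. The derivative of the new error is a Taylor remainder
plus the Lipschitz image of the old error, hence `O(r^(n+1))`, and integration over `[0, h]` adds
one order. Stopping at `n ≤ N` keeps the Taylor remainder from dominating. -/
theorem exists_norm_sub_taylorPicard_le (hg : ContDiff ℝ ∞ fun x : State d × ℝ => g x.1 x.2)
    (hy : ∀ t ∈ Icc (0 : ℝ) T, HasDerivWithinAt y (g (y t) t) (Icc 0 T) t) (N n : ℕ)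
    (hn : n ≤ N) :
    ∃ C, 0 ≤ C ∧ ∀ t h, 0 ≤ t → 0 ≤ h → h ≤ 1 → t + h ≤ T →
      ‖y (t + h) - y t - taylorPicard N (jet g (y t, t)) n h‖ ≤ C * h ^ (n + 1) := by
  obtain ⟨R, hR0, hR⟩ := exists_norm_prod_le_of_continuousOn
    fun t ht => (hy t ht).continuousWithinAt
  obtain ⟨G, hG0, hG⟩ := hg.continuous.exists_norm_le_of_norm_le R
  have hlip : ∀ t h, 0 ≤ t → 0 ≤ h → t + h ≤ T → ‖y (t + h) - y t‖ ≤ G * h := by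
    intro t h ht hh hth
    have := norm_image_sub_le_of_norm_deriv_le_segment'
      (fun r hr => hasDerivWithinAt_shift hy ht hth hr)
      (fun r hr => hG (y (t + r), t + r) (hR (t + r) ⟨add_nonneg ht hr.1, by linarith [hr.2]⟩))
      h (right_mem_Icc.2 hh)
    simpa using this
  induction n with
  | zero =>
    refine ⟨G, hG0, fun t h ht hh _ hth => ?_⟩
    simpa [taylorPicard] using hlip t h ht hh hth
  | succ n ih =>
    obtain ⟨C, hC0, hC⟩ := ih (by omega)
    obtain ⟨M, hM0, hM⟩ := (contDiff_jet hg N).continuous.exists_norm_le_of_norm_le R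
    obtain ⟨B, hB0, hB⟩ := (continuous_taylorPicard (d := d) (N := N) n).exists_norm_le_of_norm_le
      (max M 1)
    obtain ⟨C₁, hC₁0, hC₁⟩ := exists_norm_sub_taylorField_le hg N (max R (G + 1))
    obtain ⟨L, hL0, hL⟩ := ((contDiff_taylorField (d := d) (N := N)).of_le (m := 1)
      (by exact_mod_cast le_top)).exists_norm_sub_le_of_norm_le (M + B + G + 1)
    refine ⟨C₁ * (G + 1) ^ (N + 1) + L * C, by positivity, fun t h ht hh hh1 hth => ?_⟩
    set u : DiffIndex d N → ℝ := jet g (y t, t) with hu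
    have htR : ‖(y t, t)‖ ≤ R := hR t ⟨ht, by linarith⟩
    have hbound : ∀ r ∈ Ico (0 : ℝ) h,
        ‖g (y (t + r)) (t + r) - taylorField N u (taylorPicard N u n r) r‖
          ≤ (C₁ * (G + 1) ^ (N + 1) + L * C) * h ^ (n + 1) := by
      intro r hr
      have hr1 : r ≤ 1 := hr.2.le.trans hh1
      have hrT : t + r ≤ T := by linarith [hr.2]
      have hl := hlip t r ht hr.1 hrT
      have hGr : G * r ≤ G := mul_le_of_le_one_right hG0 hr1
      have hrabs : |r| = r := abs_of_nonneg hr.1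
      have h1 := hC₁ (y t, t) (y (t + r) - y t) r ((G + 1) * r) (htR.trans (le_max_left _ _))
        (hl.trans (by nlinarith [hr.1])) (by nlinarith [hr.1])
        ((mul_le_of_le_one_right (by positivity) hr1).trans (le_max_right _ _))
      simp only [add_sub_cancel] at h1
      have hPb : ‖taylorPicard N u n r‖ ≤ B := hB (u, r)
        (max_le ((hM _ htR).trans (le_max_left _ _))
          (by rw [Real.norm_eq_abs, hrabs]; exact hr1.trans (le_max_right _ _)))
      have h2 := hL (u, y (t + r) - y t, r) (u, taylorPicard N u n r, r)
        (max_le (by linarith [hM _ htR]) (max_le (by linarith)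
          (by rw [Real.norm_eq_abs, hrabs]; linarith)))
        (max_le (by linarith [hM _ htR]) (max_le (by linarith)
          (by rw [Real.norm_eq_abs, hrabs]; linarith)))
      have hCr := hC t r ht hr.1 hr1 hrT
      have h3 : ‖((u, y (t + r) - y t, r) : (DiffIndex d N → ℝ) × State d × ℝ)
          - (u, taylorPicard N u n r, r)‖ ≤ C * r ^ (n + 1) := by
        have : 0 ≤ C * r ^ (n + 1) := mul_nonneg hC0 (pow_nonneg hr.1 _)
        exact max_le (by simpa using this) (max_le hCr (by simpa using this))
      calc _ ≤ _ + _ := norm_sub_le_norm_sub_add_norm_sub _ _ _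
        _ ≤ C₁ * ((G + 1) * r) ^ (N + 1) + L * (C * r ^ (n + 1)) :=
          add_le_add h1 (h2.trans (by gcongr))
        _ ≤ C₁ * ((G + 1) ^ (N + 1) * r ^ (n + 1)) + L * (C * r ^ (n + 1)) := by
          rw [mul_pow]
          have := pow_le_pow_of_le_one hr.1 hr1 (show n + 1 ≤ N + 1 by omega)
          gcongr
        _ = (C₁ * (G + 1) ^ (N + 1) + L * C) * r ^ (n + 1) := by ring
        _ ≤ _ := by
          have := hr.1
          have := hr.2.le
          gcongr
    have hderiv : ∀ r ∈ Icc (0 : ℝ) h, HasDerivWithinAt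
        (fun r => y (t + r) - y t - taylorPicard N u (n + 1) r)
        (g (y (t + r)) (t + r) - taylorField N u (taylorPicard N u n r) r) (Icc 0 h) r :=
      fun r hr => ((hasDerivWithinAt_shift hy ht hth hr).sub_const _).sub
        (hasDerivAt_taylorPicard u n r).hasDerivWithinAt
    have := norm_image_sub_le_of_norm_deriv_le_segment' hderiv hbound h (right_mem_Icc.2 hh)
    simpa [taylorPicard_apply_zero, pow_succ, mul_assoc] using this

end ExactSolution

/-! ### The local error and its principal part. -/

namespace RKScheme

variable {s d p : ℕ} (S : RKScheme s)

/-- The local error of the scheme for the Taylor polynomial vector field with partial derivatives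
`u`, the exact solution being replaced by a Picard iterate. -/
noncomputable def localDefect (N : ℕ) (u : DiffIndex d N → ℝ) (h : ℝ) : State d :=
  taylorPicard N u N h - h • S.increment (taylorField N u) (fun t => t) h 0 0

theorem isPolynomialFamily_localDefect (N : ℕ) (j : Fin d) :
    IsPolynomialFamily fun u h => S.localDefect N u h j := by
  have := (isPolynomialFamily_taylorPicard (N := N) N j).sub (IsPolynomialFamily.var.mul
    (IsPolynomialFamily.sum Finset.univ fun i _ =>
      (IsPolynomialFamily.const (S.b i)).mul (S.isPolynomialFamily_stage i j)))
  simpa [localDefect, increment] using this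

theorem localDefect_zero (N : ℕ) (h : ℝ) :
    S.localDefect N (fun _ : DiffIndex d N => 0) h = 0 := by
  simp [localDefect, increment, taylorPicard_zero, stage_taylorField_zero]

theorem exists_norm_localError_sub_localDefect_le {g : State d → ℝ → State d} {y : ℝ → State d}
    {T : ℝ} (hg : ContDiff ℝ ∞ fun x : State d × ℝ => g x.1 x.2)
    (hy : ∀ t ∈ Icc (0 : ℝ) T, HasDerivWithinAt y (g (y t) t) (Icc 0 T) t) (N : ℕ) :
    ∃ C, 0 ≤ C ∧ ∀ t h, 0 ≤ t → 0 ≤ h → h ≤ 1 → t + h ≤ T →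
      ‖y (t + h) - (y t + h • S.increment g (fun t => t) h t (y t))
        - S.localDefect N (jet g (y t, t)) h‖ ≤ C * h ^ (N + 1) := by
  obtain ⟨R, hR0, hR⟩ := exists_norm_prod_le_of_continuousOn
    fun t ht => (hy t ht).continuousWithinAt
  obtain ⟨C₁, hC₁0, hC₁⟩ := exists_norm_sub_taylorPicard_le hg hy N N le_rfl
  obtain ⟨C₂, hC₂0, hC₂⟩ := S.exists_norm_increment_sub_le hg N R
  refine ⟨C₁ + C₂, by positivity, fun t h ht hh hh1 hth => ?_⟩
  have h1 := hC₁ t h ht hh hh1 hth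
  have h2 := hC₂ (y t, t) h (hR t ⟨ht, by linarith⟩) hh hh1
  have heq : y (t + h) - (y t + h • S.increment g (fun t => t) h t (y t))
      - S.localDefect N (jet g (y t, t)) h
      = (y (t + h) - y t - taylorPicard N (jet g (y t, t)) N h)
        - h • (S.increment g (fun t => t) h t (y t)
          - S.increment (taylorField N (jet g (y t, t))) (fun t => t) h 0 0) := by
    rw [localDefect, smul_sub]
    abel
  rw [heq, add_mul]
  refine (norm_sub_le _ _).trans (add_le_add h1 ?_)
  rw [norm_smul, Real.norm_of_nonneg hh]
  exact (mul_le_of_le_one_left (norm_nonneg _) hh1).trans h2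

/-- The principal part of the local error of a scheme of order `p` is a universal polynomial in the
partial derivatives of the vector field. -/
theorem exists_principal_localError (hS : S.HasOrder p) (d : ℕ) :
    ∃ P : Fin d → MvPolynomial (DiffIndex d (p + 1)) ℝ,
      (∀ i, MvPolynomial.eval (fun _ => (0 : ℝ)) (P i) = 0) ∧
      ∀ (g : State d → ℝ → State d) (y : ℝ → State d) (T : ℝ), 0 < T →
        ContDiff ℝ ∞ (fun x : State d × ℝ => g x.1 x.2) →
        (∀ t ∈ Icc (0 : ℝ) T, HasDerivWithinAt y (g (y t) t) (Icc 0 T) t) →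
        ∃ C, 0 ≤ C ∧ ∀ t h, 0 ≤ t → 0 ≤ h → h ≤ 1 → t + h ≤ T →
          ‖y t + h • S.increment g (fun t => t) h t (y t) - y (t + h)
            - h ^ (p + 1) • evalPoly P (jet g (y t, t))‖ ≤ C * h ^ (p + 2) := by
  choose Q hQ using S.isPolynomialFamily_localDefect (d := d) (p + 1)
  -- The sign changes because the defect is exact minus numerical, while `P` describes numerical
  -- minus exact.
  refine ⟨fun j => -(Q j).coeff (p + 1), fun j => ?_, fun g y T hT hg hy => ?_⟩
  · have h0 : (Q j).map (MvPolynomial.eval fun _ => (0 : ℝ)) = 0 := by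
      refine Polynomial.funext fun h => ?_
      rw [Polynomial.eval_map, ← hQ j (fun _ => 0) h]
      simp [localDefect_zero]
    have := congrArg (fun q => Polynomial.coeff q (p + 1)) h0
    simp only [Polynomial.coeff_map, Polynomial.coeff_zero] at this
    rw [map_neg, this, neg_zero]
  · have hyc : ContinuousOn y (Icc 0 T) := fun t ht => (hy t ht).continuousWithinAt
    obtain ⟨R, hR0, hR⟩ := exists_norm_prod_le_of_continuousOn hyc
    obtain ⟨M, hM0, hM⟩ := (contDiff_jet hg (p + 1)).continuous.exists_norm_le_of_norm_le R
    obtain ⟨C₁, hC₁0, hC₁⟩ := S.exists_norm_localError_sub_localDefect_le hg hy (p + 1)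
    have hcoeff : ∀ t ∈ Icc (0 : ℝ) T, ∀ j, ∀ k ≤ p,
        MvPolynomial.eval (jet g (y t, t)) ((Q j).coeff k) = 0 := by
      intro t ht j k hk
      -- The order condition needs a solution on a neighbourhood of `t`, so it applies at interior
      -- times only; continuity extends the vanishing to the endpoints. Its constants may depend on
      -- `t`, since only vanishing coefficients are extracted from it.
      have hopen : EqOn (fun t => MvPolynomial.eval (jet g (y t, t)) ((Q j).coeff k))
          (fun _ => 0) (Ioo 0 T) := by
        intro t ht
        have hord := hS d g hg t y (by
          filter_upwards [Ioo_mem_nhds ht.1 ht.2] with r hr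
          exact (hy r (Ioo_subset_Icc_self hr)).hasDerivAt (Icc_mem_nhds hr.1 hr.2))
        have hdef : (fun h : ℝ => S.localDefect (p + 1) (jet g (y t, t)) h)
            =O[𝓝[>] (0 : ℝ)] fun h : ℝ => h ^ (p + 1) := by
          have hrem : (fun h : ℝ => y (t + h) - (y t + h • S.increment g (fun t => t) h t (y t))
              - S.localDefect (p + 1) (jet g (y t, t)) h)
              =O[𝓝[>] (0 : ℝ)] fun h : ℝ => h ^ (p + 1) := by
            refine Asymptotics.IsBigO.of_bound C₁ ?_
            filter_upwards [Ioo_mem_nhdsGT (lt_min one_pos (sub_pos.2 ht.2))] with h hh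
            have hh1 : h ≤ 1 := hh.2.le.trans (min_le_left _ _)
            refine (hC₁ t h ht.1.le hh.1.le hh1
              (by linarith [hh.2.trans_le (min_le_right _ _)])).trans ?_
            rw [Real.norm_of_nonneg (pow_nonneg hh.1.le _)]
            exact mul_le_mul_of_nonneg_left (pow_le_pow_of_le_one hh.1.le hh1 (by omega)) hC₁0
          exact (hord.sub hrem).congr_left fun h => by abel
        have hpoly : (fun h : ℝ => ((Q j).map (MvPolynomial.eval (jet g (y t, t)))).eval h)
            =O[𝓝[>] (0 : ℝ)] fun h : ℝ => h ^ (p + 1) := by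
          refine Asymptotics.IsBigO.trans (Asymptotics.IsBigO.of_bound 1 (Eventually.of_forall
            fun h => ?_)) hdef
          rw [Polynomial.eval_map, ← hQ j, one_mul]
          exact EuclideanSpace.abs_apply_le _ _
        have := Polynomial.coeff_eq_zero_of_isBigO hpoly k hk
        rwa [Polynomial.coeff_map] at this
      refine hopen.of_subset_closure ?_ continuousOn_const Ioo_subset_Icc_self
        (by rw [closure_Ioo hT.ne]) ht
      exact ((MvPolynomial.continuous_eval _).comp (contDiff_jet hg _).continuous).comp_continuousOn
        (hyc.prodMk continuousOn_id)
    choose K hK0 hK using fun j => (Q j).exists_abs_eval₂_sub_le (p + 1) M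
    refine ⟨C₁ + d * ∑ j, K j, add_nonneg hC₁0 (mul_nonneg (by positivity)
      (Finset.sum_nonneg fun j _ => hK0 j)), fun t h ht hh hh1 hth => ?_⟩
    set u : DiffIndex d (p + 1) → ℝ := jet g (y t, t) with hu
    have htT : t ∈ Icc 0 T := ⟨ht, by linarith⟩
    have h1 : ‖S.localDefect (p + 1) u h + h ^ (p + 1) • evalPoly
        (fun j => -(Q j).coeff (p + 1)) u‖ ≤ d * ((∑ j, K j) * h ^ (p + 2)) := by
      refine EuclideanSpace.norm_le_card_mul fun j => ?_
      have := hK j u h (hM _ (hR t htT)) hh hh1 fun k hk => hcoeff t htT j k (by omega)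
      rw [← hQ j] at this
      have heq : (S.localDefect (p + 1) u h + h ^ (p + 1) • evalPoly
          (fun j => -(Q j).coeff (p + 1)) u) j
          = S.localDefect (p + 1) u h j
            - MvPolynomial.eval u ((Q j).coeff (p + 1)) * h ^ (p + 1) := by
        simp [evalPoly]
        ring
      rw [heq]
      refine this.trans ?_
      gcongr
      exact Finset.single_le_sum (fun j _ => hK0 j) (Finset.mem_univ j)
    have heq : y t + h • S.increment g (fun t => t) h t (y t) - y (t + h)
        - h ^ (p + 1) • evalPoly (fun j => -(Q j).coeff (p + 1)) u
        = -(y (t + h) - (y t + h • S.increment g (fun t => t) h t (y t))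
            - S.localDefect (p + 1) u h)
          - (S.localDefect (p + 1) u h + h ^ (p + 1) • evalPoly
            (fun j => -(Q j).coeff (p + 1)) u) := by abel
    rw [heq]
    refine (norm_sub_le _ _).trans ?_
    rw [norm_neg, add_mul, mul_assoc (d : ℝ)]
    exact add_le_add (hC₁ t h ht hh hh1 hth) h1

/-- A scheme of positive order is consistent. -/
theorem sum_b_eq_one (hS : S.HasOrder p) (hp : 1 ≤ p) : ∑ i, S.b i = 1 := by
  -- For a constant unit field the error of one step is exactly `(1 - ∑ bᵢ) h` times the unit
  -- vector.
  have h := hS 1 (fun _ _ => EuclideanSpace.single 0 1) contDiff_const 0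
    (fun t => t • EuclideanSpace.single 0 1) (Eventually.of_forall fun t => by
      simpa using (hasDerivAt_id t).smul_const (EuclideanSpace.single (0 : Fin 1) (1 : ℝ)))
  set Q : Polynomial ℝ := Polynomial.C (1 - ∑ i, S.b i) * Polynomial.X with hQ
  have hQO : (fun h : ℝ => Q.eval h) =O[𝓝[>] (0 : ℝ)] fun h : ℝ => h ^ (p + 1) := by
    refine Asymptotics.IsBigO.trans (Asymptotics.IsBigO.of_bound 1 (Eventually.of_forall
      fun r => ?_)) h
    have hstage : ∀ y i, S.stage (fun (_ : State 1) (_ : ℝ) => EuclideanSpace.single 0 (1 : ℝ))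
        (fun t => t) r 0 y i = EuclideanSpace.single 0 1 := fun y i => by rw [stage]
    simp only [increment, hstage, ← Finset.sum_smul, smul_smul, zero_add, zero_smul, one_mul]
    rw [← sub_smul, norm_smul, PiLp.norm_single, norm_one, mul_one, hQ]
    simp only [Polynomial.eval_mul, Polynomial.eval_C, Polynomial.eval_X]
    exact le_of_eq (by congr 1; ring)
  have := Polynomial.coeff_eq_zero_of_isBigO hQO 1 hp
  rw [hQ, Polynomial.coeff_C_mul, Polynomial.coeff_X_one, mul_one] at this
  linarith

end RKScheme

/-- A discrete Grönwall inequality whose recursion is only available as long as the sequence stays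
below the a priori bound `K`. -/
theorem discrete_gronwall_bootstrap {a : ℕ → ℝ} {Λ h ε T K : ℝ} (hh : 0 ≤ h) (hΛ : 0 ≤ Λ)
    (hε : 0 ≤ ε) (ha : a 0 ≤ 0) (hK : ε * T * Real.exp (Λ * T) ≤ K)
    (hstep : ∀ n : ℕ, ((n + 1 : ℕ) : ℝ) * h ≤ T → a n ≤ K →
      a (n + 1) ≤ (1 + Λ * h) * a n + h * ε) (n : ℕ) (hn : n * h ≤ T) :
    a n ≤ ε * T * Real.exp (Λ * T) := by
  have hmono : ∀ n : ℕ, (n : ℝ) * h ≤ T →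
      ε * (n * h) * Real.exp (Λ * (n * h)) ≤ ε * T * Real.exp (Λ * T) := by
    intro n hn
    have : 0 ≤ (n : ℝ) * h := by positivity
    have : 0 ≤ T := this.trans hn
    gcongr
  have key : ∀ n : ℕ, (n : ℝ) * h ≤ T → a n ≤ ε * (n * h) * Real.exp (Λ * (n * h)) := by
    intro n
    induction n with
    | zero => exact fun _ => by simpa using ha
    | succ n ih =>
      intro hn
      have hn' : (n : ℝ) * h ≤ T := by push_cast at hn; linarith
      have h1 := ih hn'
      have h2 := hstep n hn (h1.trans ((hmono n hn').trans hK))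
      have hexp : 1 + Λ * h ≤ Real.exp (Λ * h) := by linarith [Real.add_one_le_exp (Λ * h)]
      have hexp1 : 1 ≤ Real.exp (Λ * ((n + 1 : ℕ) * h)) := Real.one_le_exp (by positivity)
      have hsplit : Real.exp (Λ * ((n + 1 : ℕ) * h))
          = Real.exp (Λ * h) * Real.exp (Λ * (n * h)) := by
        rw [← Real.exp_add]; congr 1; push_cast; ring
      calc a (n + 1) ≤ (1 + Λ * h) * a n + h * ε := h2
        _ ≤ (1 + Λ * h) * (ε * (n * h) * Real.exp (Λ * (n * h))) + h * ε := by gcongr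
        _ ≤ Real.exp (Λ * h) * (ε * (n * h) * Real.exp (Λ * (n * h)))
            + h * ε * Real.exp (Λ * ((n + 1 : ℕ) * h)) := by
          exact add_le_add (by gcongr) (le_mul_of_one_le_right (by positivity) hexp1)
        _ = _ := by rw [hsplit]; push_cast; ring
  exact (key n hn).trans (hmono n hn)

/-! ### Regularity of the forcing term of the variational equation. -/

section EvalPoly

variable {d : ℕ} {ι : Type*}

theorem contDiff_evalPoly [Fintype ι] (P : Fin d → MvPolynomial ι ℝ) :
    ContDiff ℝ ∞ (evalPoly P) :=
  contDiff_euclidean.2 fun i =>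
    contDiffOn_univ.1 (AnalyticOnNhd.eval_mvPolynomial (P i)).contDiffOn_of_completeSpace

theorem continuous_scaledDiff {g : State d → ℝ → State d}
    (hg : ContDiff ℝ ∞ fun x : State d × ℝ => g x.1 x.2) (N : ℕ) (h τ : ℝ) :
    Continuous fun x : State d => scaledDiff (N := N) g (fun t => t) h τ x := by
  refine continuous_pi fun k => ?_
  have : ∀ x, scaledDiff (N := N) g (fun t => t) h τ x k = (h ^ k.m)⁻¹ *
      ∑ i ∈ Finset.range (k.m + 1), ((-1 : ℤ) ^ (k.m - i) * k.m.choose i) •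
        stateDeriv g k.j k.l k.dir (x, τ + i • h) := by
    intro x
    rw [← fwdDiff_iter_eq_sum_shift h (fun σ => stateDeriv g k.j k.l k.dir (x, σ))]
    rfl
  simp only [this]
  refine continuous_const.mul (continuous_finsetSum _ fun i _ => Continuous.fun_const_smul ?_ _)
  exact (contDiff_stateDeriv hg k.j k.l k.dir).continuous.comp
    (continuous_id.prodMk continuous_const)

end EvalPoly

/-! ### The increment function, convergence, and solvability of the variational equation. -/

namespace RKScheme

variable {s d p : ℕ} (S : RKScheme s) {g : State d → ℝ → State d} {y : ℝ → State d} {T : ℝ}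

theorem approx_eq {W : Type*} (f : State d → W → State d) (θ : ℝ → W) (y₀ : State d) {h : ℝ}
    (hh : h ≠ 0) (t : ℝ) {n : ℕ} (hn : ⌊t / h⌋₊ = n) :
    S.approx f θ y₀ h t
      = S.node f θ y₀ h n + (t - n * h) • S.increment f θ h (n * h) (S.node f θ y₀ h n) := by
  have hdiv : (t / h - n) * h = t - n * h := by field_simp
  rw [approx, hn, AffineMap.lineMap_apply_module', node, add_sub_cancel_left, smul_smul, hdiv,
    add_comm]

theorem floor_div_eq {h t : ℝ} (hh : 0 < h) {n : ℕ} (h1 : n * h ≤ t)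
    (h2 : t < ((n + 1 : ℕ) : ℝ) * h) : ⌊t / h⌋₊ = n := by
  rw [Nat.floor_eq_iff (div_nonneg ((by positivity : (0 : ℝ) ≤ n * h).trans h1) hh.le)]
  rw [le_div_iff₀ hh, div_lt_iff₀ hh]
  exact ⟨h1, by exact_mod_cast h2⟩

theorem approx_grid {W : Type*} (f : State d → W → State d) (θ : ℝ → W) (y₀ : State d) {h : ℝ}
    (hh : 0 < h) (n : ℕ) : S.approx f θ y₀ h (n * h) = S.node f θ y₀ h n := by
  have : ((n : ℝ)) * h < ((n + 1 : ℕ) : ℝ) * h := by push_cast; linarith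
  rw [S.approx_eq f θ y₀ hh.ne' _ (floor_div_eq hh le_rfl this), sub_self, zero_smul, add_zero]

theorem increment_at_zero (hb : ∑ i, S.b i = 1) (t : ℝ) (x : State d) :
    S.increment g (fun t => t) 0 t x = g x t := by
  have : ∀ i, S.stage g (fun t => t) 0 t x i = g x t := fun i => by rw [stage]; simp
  simp only [increment, this, ← Finset.sum_smul, hb, one_smul]

/-- Different step sizes are allowed because, between grid points, a step of size `h` is compared
with one of the shorter size `t - nh`. -/
theorem exists_norm_increment_lipschitz
    (hg : ContDiff ℝ ∞ fun x : State d × ℝ => g x.1 x.2) (R : ℝ) :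
    ∃ C, 0 ≤ C ∧ ∀ h h' t x x', |h| ≤ R → |h'| ≤ R → |t| ≤ R → ‖x‖ ≤ R → ‖x'‖ ≤ R →
      ‖S.increment g (fun t => t) h' t x' - S.increment g (fun t => t) h t x‖
        ≤ C * max |h' - h| ‖x' - x‖ := by
  obtain ⟨C, hC0, hC⟩ := ((S.contDiff_increment_of_field hg).of_le (m := 1)
    (by exact_mod_cast le_top)).exists_norm_sub_le_of_norm_le R
  refine ⟨C, hC0, fun h h' t x x' hh hh' ht hx hx' => ?_⟩
  refine (hC (h', t, x') (h, t, x) (max_le hh' (max_le ht hx')) (max_le hh (max_le ht hx))).trans ?_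
  refine mul_le_mul_of_nonneg_left (max_le (le_max_left _ _) (max_le ?_ (le_max_right _ _))) hC0
  change ‖t - t‖ ≤ _
  rw [sub_self, norm_zero]
  exact le_max_of_le_left (abs_nonneg _)

/-- At `h = 0` the increment is `g` itself, so `∂g/∂y` is its state derivative there. On the segment
from `x` to `x'` the state derivative at step size `h` differs from it by `O(h + ‖x' - x‖)`. -/
theorem exists_norm_increment_linearization (hb : ∑ i, S.b i = 1)
    (hg : ContDiff ℝ ∞ fun x : State d × ℝ => g x.1 x.2) (R : ℝ) (hR : 1 ≤ R) :
    ∃ C, 0 ≤ C ∧ ∀ h t x x', 0 ≤ h → h ≤ 1 → |t| ≤ R → ‖x‖ ≤ R → ‖x'‖ ≤ R →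
      ‖S.increment g (fun t => t) h t x' - S.increment g (fun t => t) h t x
        - fderiv ℝ (fun z => g z t) x (x' - x)‖ ≤ C * (h + ‖x' - x‖) * ‖x' - x‖ := by
  have hΦ := S.contDiff_increment_of_field hg
  have hD : ContDiff ℝ ∞ fun w : ℝ × ℝ × State d =>
      fderiv ℝ (fun z => S.increment g (fun t => t) w.1 w.2.1 z) w.2.2 :=
    ContDiff.fderiv (m := ∞) (n := ∞)
      (f := fun (w : ℝ × ℝ × State d) z => S.increment g (fun t => t) w.1 w.2.1 z)
      (hΦ.comp ((contDiff_fst.comp contDiff_fst).prodMk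
        (((contDiff_fst.comp contDiff_snd).comp contDiff_fst).prodMk contDiff_snd)))
      (contDiff_snd.comp contDiff_snd) (by simp)
  obtain ⟨C, hC0, hC⟩ := (hD.of_le (m := 1) (by exact_mod_cast le_top)).exists_norm_sub_le_of_norm_le R
  refine ⟨C, hC0, fun h t x x' hh hh1 ht hx hx' => ?_⟩
  have hfd : fderiv ℝ (fun z => g z t) x
      = fderiv ℝ (fun z => S.increment g (fun t => t) 0 t z) x := by
    simp only [S.increment_at_zero hb]
  have hdiff : Differentiable ℝ fun z => S.increment g (fun t => t) h t z :=
    (hΦ.comp (contDiff_const.prodMk (contDiff_const.prodMk contDiff_id))).differentiable (by simp)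
  rw [hfd]
  refine (convex_segment x x').norm_image_sub_le_of_norm_fderiv_le' (𝕜 := ℝ)
    (fun z _ => hdiff z) (fun z hz => ?_) (left_mem_segment ℝ x x') (right_mem_segment ℝ x x')
  have hzR : ‖z‖ ≤ R := by
    have := (convex_closedBall (0 : State d) R).segment_subset
      (by simpa using hx : x ∈ Metric.closedBall 0 R) (by simpa using hx') hz
    simpa using this
  have hzx : ‖z - x‖ ≤ ‖x' - x‖ := by
    rw [norm_sub_rev z x, norm_sub_rev x' x, ← dist_eq_norm, ← dist_eq_norm]
    linarith [dist_add_dist_of_mem_segment hz, dist_nonneg (x := z) (y := x')]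
  have hhR : ‖h‖ ≤ R := by rw [Real.norm_of_nonneg hh]; linarith
  refine (hC (h, t, z) (0, t, x) (max_le hhR (max_le ht hzR))
    (max_le (by simp; linarith) (max_le ht hx))).trans ?_
  refine mul_le_mul_of_nonneg_left (max_le ?_ (max_le ?_ ?_)) hC0
  · change ‖h - 0‖ ≤ _
    rw [sub_zero, Real.norm_of_nonneg hh]
    linarith [norm_nonneg (x' - x)]
  · change ‖t - t‖ ≤ _
    rw [sub_self, norm_zero]
    positivity
  · change ‖z - x‖ ≤ _
    linarith

/-- Consistency of order `p` implies convergence of order `p`. -/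
theorem exists_norm_node_sub_le (hp : 1 ≤ p)
    (hg : ContDiff ℝ ∞ fun x : State d × ℝ => g x.1 x.2) (hT : 0 < T)
    (hy : ∀ t ∈ Icc (0 : ℝ) T, HasDerivWithinAt y (g (y t) t) (Icc 0 T) t) {C : ℝ} (hC : 0 ≤ C)
    (hloc : ∀ t h, 0 ≤ t → 0 ≤ h → h ≤ 1 → t + h ≤ T →
      ‖y t + h • S.increment g (fun t => t) h t (y t) - y (t + h)‖ ≤ C * h ^ (p + 1)) :
    ∃ K h₀, 0 ≤ K ∧ 0 < h₀ ∧ h₀ ≤ 1 ∧ ∀ h ∈ Ioo 0 h₀, ∀ n : ℕ, n * h ≤ T →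
      ‖S.node g (fun t => t) (y 0) h n - y (n * h)‖ ≤ K * h ^ p ∧ K * h ^ p ≤ 1 := by
  obtain ⟨R, hR0, hR⟩ := exists_norm_prod_le_of_continuousOn
    fun t ht => (hy t ht).continuousWithinAt
  obtain ⟨Λ, hΛ0, hΛ⟩ := S.exists_norm_increment_lipschitz hg (R + 1)
  set K := C * T * Real.exp (Λ * T) with hK
  have hK0 : 0 ≤ K := by positivity
  -- With `p ≥ 1`, this threshold gives `h ≤ 1` and `K * h ^ p ≤ 1`.
  refine ⟨K, 1 / (K + 1), hK0, by positivity, div_le_one_of_le₀ (by linarith) (by positivity),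
    fun h hh n hn => ?_⟩
  have hh0 := hh.1
  have hKh : h * (K + 1) < 1 := (lt_div_iff₀ (by positivity)).1 hh.2
  have hh1 : h ≤ 1 := by nlinarith
  have hhp : h ^ p ≤ h := pow_le_of_le_one hh0.le hh1 (by omega)
  have hsmall : K * h ^ p ≤ 1 := by nlinarith
  refine ⟨?_, hsmall⟩
  -- The a priori bound `1` keeps the nodes in the ball of radius `R + 1`, where the Lipschitz
  -- constant `Λ` is valid.
  have := discrete_gronwall_bootstrap
    (a := fun n => ‖S.node g (fun t => t) (y 0) h n - y (n * h)‖) (Λ := Λ) (h := h)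
    (ε := C * h ^ p) (T := T) (K := 1) hh0.le hΛ0 (by positivity) (by simp [node])
    (by calc _ = K * h ^ p := by rw [hK]; ring
          _ ≤ 1 := hsmall) ?_ n hn
  · calc _ ≤ _ := this
      _ = K * h ^ p := by rw [hK]; ring
  · intro n hn hδ
    have hn0 : (0 : ℝ) ≤ n * h := by positivity
    have hnT : n * h + h ≤ T := by push_cast at hn; linarith
    have hsucc : ((n + 1 : ℕ) : ℝ) * h = n * h + h := by push_cast; ring
    have hyR := hR (n * h) ⟨hn0, by linarith⟩
    have hy1 : ‖y (n * h)‖ ≤ R := (norm_fst_le (y (n * h), (n : ℝ) * h)).trans hyR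
    have ht1 : |(n : ℝ) * h| ≤ R := (norm_snd_le (y (n * h), (n : ℝ) * h)).trans hyR
    set x := S.node g (fun t => t) (y 0) h n with hx
    have hxR : ‖x‖ ≤ R + 1 := by linarith [norm_le_norm_add_norm_sub' x (y (n * h))]
    have hhabs : |h| ≤ R + 1 := by rw [abs_of_pos hh0]; linarith
    have h1 := hΛ h h (n * h) (y (n * h)) x hhabs hhabs (by linarith) (by linarith) hxR
    rw [sub_self, abs_zero, max_eq_right (norm_nonneg _)] at h1
    have h2 := hloc (n * h) h hn0 hh0.le hh1 hnT
    change ‖S.node g (fun t => t) (y 0) h (n + 1) - y ((n + 1 : ℕ) * h)‖ ≤ _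
    rw [hsucc, node]
    have heq : x + h • S.increment g (fun t => t) h (n * h) x - y (n * h + h)
        = (x - y (n * h)) + h • (S.increment g (fun t => t) h (n * h) x
            - S.increment g (fun t => t) h (n * h) (y (n * h)))
          + (y (n * h) + h • S.increment g (fun t => t) h (n * h) (y (n * h)) - y (n * h + h)) := by
      rw [smul_sub]; abel
    rw [← hx, heq]
    refine norm_add₃_le.trans ?_
    rw [norm_smul, Real.norm_of_nonneg hh0.le]
    calc _ ≤ ‖x - y (n * h)‖ + h * (Λ * ‖x - y (n * h)‖) + C * h ^ (p + 1) := by gcongr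
      _ = _ := by ring

/-- The variational equation along the numerical solution is solvable on the whole interval. -/
theorem exists_solvesVariational (hg : ContDiff ℝ ∞ fun x : State d × ℝ => g x.1 x.2) {N : ℕ}
    (P : Fin d → MvPolynomial (DiffIndex d N) ℝ) (y₀ : State d) {h : ℝ} (hh : 0 < h) (T : ℝ) :
    ∃ e, SolvesVariational g (fun t => t) P h T (S.approx g (fun t => t) y₀ h) e := by
  set v : ℝ → State d → State d := fun t x =>
    fderiv ℝ (fun z : State d => g z (gridPoint h t)) (S.approx g (fun t => t) y₀ h t) x
      + evalPoly P (scaledDiff g (fun t => t) h (gridPoint h t) (S.approx g (fun t => t) y₀ h t))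
    with hv
  obtain ⟨n, hn⟩ := exists_nat_gt (T / h)
  have hτ : Monotone fun k : ℕ => (k : ℝ) * h := fun i j hij => by
    have : (i : ℝ) ≤ j := by exact_mod_cast hij
    exact mul_le_mul_of_nonneg_right this hh.le
  have hpiece : ∀ (k : ℕ) (x : State d), ∃ e, e (k * h) = x ∧
      IsRightSolution v (k * h) ((k + 1 : ℕ) * h) e := by
    intro k x
    -- On one grid cell the grid time is frozen and the interpolant is this affine curve, so the
    -- coefficients extend continuously to all times. They agree with the original field on the
    -- half-open cell, which suffices for right derivatives.
    let X : ℝ → State d := fun t => S.node g (fun t => t) y₀ h k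
      + (t - k * h) • S.increment g (fun t => t) h (k * h) (S.node g (fun t => t) y₀ h k)
    have hX : Continuous X := by fun_prop
    have hA : Continuous fun t => fderiv ℝ (fun z : State d => g z (k * h)) (X t) :=
      ((hg.comp (contDiff_id.prodMk contDiff_const)).continuous_fderiv (by simp)).comp hX
    have hb : Continuous fun t => evalPoly P (scaledDiff g (fun t => t) h (k * h) (X t)) :=
      (contDiff_evalPoly P).continuous.comp ((continuous_scaledDiff hg N h (k * h)).comp hX)
    obtain ⟨e, he, he'⟩ := exists_isRightSolution_linear hA hb (hτ k.le_succ) x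
    refine ⟨e, he, he'.congr_field fun t ht => ?_⟩
    have hfl := floor_div_eq hh ht.1 ht.2
    simp only [hv, gridPoint, hfl, S.approx_eq g (fun t => t) y₀ hh.ne' t hfl, X]
  obtain ⟨e, he0, he⟩ := IsRightSolution.exists_of_chain hτ hpiece n 0
  simp only [Nat.cast_zero, zero_mul] at he0 he
  have he' := he.mono (c' := T) ((div_lt_iff₀ hh).1 hn).le
  exact ⟨e, he'.1, he0, he'.2⟩

end RKScheme

/-! ### Uniform estimates for the variational equation. -/

section Variational

variable {d N : ℕ} {g : State d → ℝ → State d} {y : ℝ → State d} {T : ℝ}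

theorem contDiff_fderiv_state (hg : ContDiff ℝ ∞ fun x : State d × ℝ => g x.1 x.2) :
    ContDiff ℝ ∞ fun z : State d × ℝ => fderiv ℝ (fun x => g x z.2) z.1 :=
  ContDiff.fderiv (m := ∞) (n := ∞) (f := fun (z : State d × ℝ) x => g x z.2)
    (hg.comp (contDiff_snd.prodMk (contDiff_snd.comp contDiff_fst))) contDiff_fst (by simp)

theorem gridPoint_mem {h t : ℝ} (hh : 0 < h) (ht : t ∈ Icc 0 T) : gridPoint h t ∈ Icc 0 T := by
  refine ⟨by unfold gridPoint; positivity, le_trans ?_ ht.2⟩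
  rw [gridPoint, ← le_div_iff₀ hh]
  exact Nat.floor_le (div_nonneg ht.1 hh.le)

/-- Bounds, uniform in the step size, for the solutions of the variational equation along curves
that stay close to the exact solution. -/
theorem exists_variational_estimates (hg : ContDiff ℝ ∞ fun x : State d × ℝ => g x.1 x.2)
    (hyc : ContinuousOn y (Icc 0 T)) (P : Fin d → MvPolynomial (DiffIndex d N) ℝ) {B : ℝ}
    (hB : 0 ≤ B) :
    ∃ C, 0 ≤ C ∧ ∀ h, 0 < h → h ≤ 1 → ∀ x e : ℝ → State d,
      (∀ t ∈ Ico 0 T, ‖x t - y (gridPoint h t)‖ ≤ B * h) →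
      SolvesVariational g (fun t => t) P h T x e →
      (∀ t ∈ Icc 0 T, ‖e t‖ ≤ C) ∧
      (∀ a b, 0 ≤ a → a ≤ b → b ≤ T → ‖e b - e a‖ ≤ C * (b - a)) ∧
      ∀ n : ℕ, n * h + h ≤ T →
        ‖e (n * h + h) - e (n * h) - h • (fderiv ℝ (fun z => g z (n * h)) (y (n * h)) (e (n * h))
          + evalPoly P (jet g (y (n * h), n * h)))‖ ≤ C * h ^ 2 := by
  obtain ⟨R, hR0, hR⟩ := exists_norm_prod_le_of_continuousOn hyc
  set A : State d × ℝ → State d →L[ℝ] State d := fun z => fderiv ℝ (fun x => g x z.2) z.1 with hA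
  have hAs : ContDiff ℝ ∞ A := contDiff_fderiv_state hg
  obtain ⟨KA, hKA0, hKA⟩ := hAs.continuous.exists_norm_le_of_norm_le (R + B)
  obtain ⟨LA, hLA0, hLA⟩ := (hAs.of_le (m := 1)
    (by exact_mod_cast le_top)).exists_norm_sub_le_of_norm_le (R + B)
  obtain ⟨M, hM0, hM⟩ := (contDiff_jet hg N).continuous.exists_norm_le_of_norm_le (R + B)
  obtain ⟨LJ, hLJ0, hLJ⟩ := ((contDiff_jet hg N).of_le (m := 1)
    (by exact_mod_cast le_top)).exists_norm_sub_le_of_norm_le (R + B)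
  obtain ⟨CS, hCS0, hCS⟩ := exists_norm_scaledDiff_sub_jet_le hg N (R + B)
  obtain ⟨BP, hBP0, hBP⟩ := (contDiff_evalPoly P).continuous.exists_norm_le_of_norm_le (M + CS)
  obtain ⟨LP, hLP0, hLP⟩ := ((contDiff_evalPoly P).of_le (m := 1)
    (by exact_mod_cast le_top)).exists_norm_sub_le_of_norm_le (M + CS)
  set Be := max (gronwallBound 0 KA BP T) 0 with hBe
  have hBe0 : 0 ≤ Be := le_max_right _ _
  set Ce := KA * Be + BP with hCe
  have hCe0 : 0 ≤ Ce := by positivity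
  -- The three terms bound, per unit of `h`, the change of the matrix, the change of `e` over one
  -- cell, and the change of the forcing (differences against jets, then `x` against `y`).
  set C₅ := LA * B * Be + KA * Ce + LP * (CS + LJ * B) with hC₅
  have hC₅0 : 0 ≤ C₅ := by positivity
  refine ⟨Be + Ce + C₅, by positivity, fun h hh hh1 x e hx he => ?_⟩
  obtain ⟨hec, he0, hed⟩ := he
  have hBh : B * h ≤ B := mul_le_of_le_one_right hB hh1
  have hgrid : ∀ t ∈ Ico 0 T, ‖(y (gridPoint h t), gridPoint h t)‖ ≤ R := fun t ht =>
    hR _ (gridPoint_mem hh ⟨ht.1, ht.2.le⟩)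
  have hxR : ∀ t ∈ Ico 0 T, ‖(x t, gridPoint h t)‖ ≤ R + B := by
    intro t ht
    have h1 := hgrid t ht
    have h2 := (norm_fst_le (y (gridPoint h t), gridPoint h t)).trans h1
    have h3 := (norm_snd_le (y (gridPoint h t), gridPoint h t)).trans h1
    refine max_le ?_ (h3.trans (by linarith))
    change ‖x t‖ ≤ _
    have h4 := norm_le_norm_add_norm_sub' (x t) (y (gridPoint h t))
    simp only at h2
    linarith [hx t ht]
  have hxy : ∀ t ∈ Ico 0 T,
      ‖(x t, gridPoint h t) - (y (gridPoint h t), gridPoint h t)‖ ≤ B * h := fun t ht =>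
    max_le (hx t ht) (by simp; positivity)
  set D : ℝ → DiffIndex d N → ℝ := fun t => scaledDiff g (fun t => t) h (gridPoint h t) (x t)
    with hD
  have hDJ : ∀ t ∈ Ico 0 T, ‖D t - jet g (x t, gridPoint h t)‖ ≤ CS * h := fun t ht =>
    hCS (x t, gridPoint h t) h (hxR t ht) hh hh1
  have hDM : ∀ t ∈ Ico 0 T, ‖D t‖ ≤ M + CS := fun t ht => by
    have h1 := norm_le_norm_add_norm_sub' (D t) (jet g (x t, gridPoint h t))
    have h2 := hM _ (hxR t ht)
    have h3 : CS * h ≤ CS := mul_le_of_le_one_right hCS0 hh1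
    linarith [hDJ t ht]
  set e' : ℝ → State d := fun t => A (x t, gridPoint h t) (e t) + evalPoly P (D t) with he'
  have hbound : ∀ t ∈ Ico 0 T, ‖e' t‖ ≤ KA * ‖e t‖ + BP := fun t ht =>
    (norm_add_le _ _).trans (add_le_add ((A _).le_of_opNorm_le (hKA _ (hxR t ht)) _)
      (hBP _ (hDM t ht)))
  have hebound : ∀ t ∈ Icc 0 T, ‖e t‖ ≤ Be := fun t ht => by
    have h1 := norm_le_gronwallBound_of_norm_deriv_right_le (δ := 0) hec hed (by simp [he0])
      hbound t ht
    rw [sub_zero] at h1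
    exact h1.trans ((gronwallBound_mono le_rfl hBP0 hKA0 ht.2).trans (le_max_left _ _))
  have he'bound : ∀ t ∈ Ico 0 T, ‖e' t‖ ≤ Ce := fun t ht => (hbound t ht).trans (by
    have := hebound t ⟨ht.1, ht.2.le⟩
    rw [hCe]
    gcongr)
  have hlip : ∀ a b, 0 ≤ a → a ≤ b → b ≤ T → ‖e b - e a‖ ≤ Ce * (b - a) := fun a b ha hab hb =>
    norm_image_sub_le_of_norm_deriv_right_le_segment (hec.mono (Icc_subset_Icc ha hb))
      (fun t ht => hed t ⟨ha.trans ht.1, ht.2.trans_le hb⟩)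
      (fun t ht => he'bound t ⟨ha.trans ht.1, ht.2.trans_le hb⟩) b (right_mem_Icc.2 hab)
  refine ⟨fun t ht => (hebound t ht).trans (by linarith), fun a b ha hab hb =>
    (hlip a b ha hab hb).trans (mul_le_mul_of_nonneg_right (by linarith) (sub_nonneg.2 hab)),
    fun n hn => ?_⟩
  set τ := (n : ℝ) * h with hτ
  have hτ0 : 0 ≤ τ := by positivity
  set c : State d := A (y τ, τ) (e τ) + evalPoly P (jet g (y τ, τ)) with hc
  have hgp : ∀ t ∈ Ico τ (τ + h), gridPoint h t = τ := fun t ht => by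
    rw [gridPoint, RKScheme.floor_div_eq hh ht.1 (by push_cast; linarith [ht.2])]
  have hdiff : ∀ t ∈ Ico τ (τ + h), ‖e' t - c‖ ≤ C₅ * h := by
    intro t ht
    have htT : t ∈ Ico 0 T := ⟨hτ0.trans ht.1, ht.2.trans_le hn⟩
    have hxR' := hxR t htT
    have hxy' := hxy t htT
    have hyR' := hgrid t htT
    have hDJ' := hDJ t htT
    rw [hgp t ht] at hxR' hxy' hyR' hDJ'
    have hyR'' : ‖(y τ, τ)‖ ≤ R + B := by linarith
    have h1 : ‖A (x t, τ) - A (y τ, τ)‖ ≤ LA * (B * h) :=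
      (hLA _ _ hxR' hyR'').trans (by gcongr)
    have h2 : ‖e t - e τ‖ ≤ Ce * h :=
      (hlip τ t hτ0 ht.1 htT.2.le).trans (by gcongr; linarith [ht.2])
    have h3 : ‖jet g (x t, τ) - jet (N := N) g (y τ, τ)‖ ≤ LJ * (B * h) :=
      (hLJ _ _ hxR' hyR'').trans (by gcongr)
    have h4 : ‖evalPoly P (D t) - evalPoly P (jet g (y τ, τ))‖ ≤ LP * (CS * h + LJ * (B * h)) := by
      refine (hLP _ _ (hDM t htT) ((hM _ hyR'').trans (by linarith))).trans ?_
      gcongr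
      exact (norm_sub_le_norm_sub_add_norm_sub _ _ _).trans (add_le_add hDJ' h3)
    have heq : e' t - c = (A (x t, τ) - A (y τ, τ)) (e t) + A (y τ, τ) (e t - e τ)
        + (evalPoly P (D t) - evalPoly P (jet g (y τ, τ))) := by
      simp only [he', hc, hgp t ht, sub_apply, map_sub]
      abel
    rw [heq]
    refine norm_add₃_le.trans ?_
    calc _ ≤ LA * (B * h) * Be + KA * (Ce * h) + LP * (CS * h + LJ * (B * h)) :=
          add_le_add (add_le_add (((A (x t, τ) - A (y τ, τ)).le_of_opNorm_le h1 _).trans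
              (by gcongr; exact hebound t ⟨htT.1, htT.2.le⟩))
            (((A (y τ, τ)).le_of_opNorm_le (hKA _ hyR'') _).trans (by gcongr))) h4
      _ = C₅ * h := by rw [hC₅]; ring
  have hsub : Icc τ (τ + h) ⊆ Icc 0 T := Icc_subset_Icc hτ0 hn
  -- Subtracting `t • c` leaves a function with derivative `O(h)` on a cell of length `h`, so the
  -- Euler step for `e` has error `O(h^2)`.
  have key := norm_image_sub_le_of_norm_deriv_right_le_segment
    (f := fun t => e t - t • c) (f' := fun t => e' t - c) (a := τ) (b := τ + h) (C := C₅ * h)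
    ((hec.mono hsub).sub (by fun_prop)) (fun t ht => by
      have h1 := hed t ⟨hτ0.trans ht.1, ht.2.trans_le hn⟩
      have h2 := ((hasDerivAt_id t).smul_const c).hasDerivWithinAt (s := Ici t)
      rw [one_smul] at h2
      exact h1.sub h2) hdiff (τ + h) (right_mem_Icc.2 (by linarith))
  have heq : e (τ + h) - e τ - h • c = e (τ + h) - (τ + h) • c - (e τ - τ • c) := by
    rw [add_smul]; abel
  change ‖e (τ + h) - e τ - h • c‖ ≤ _
  rw [heq]
  calc _ ≤ C₅ * h * (τ + h - τ) := key
    _ = C₅ * h ^ 2 := by ring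
    _ ≤ _ := by gcongr; linarith

end Variational

/-! ### The expansion of the global error. -/

namespace RKScheme

variable {s d p : ℕ} (S : RKScheme s) {g : State d → ℝ → State d} {y : ℝ → State d} {T : ℝ}

/-- The first order expansion of the global error. -/
theorem exists_globalError_expansion (hp : 1 ≤ p) (hb : ∑ i, S.b i = 1)
    (hg : ContDiff ℝ ∞ fun x : State d × ℝ => g x.1 x.2) (hT : 0 < T)
    (hy : ∀ t ∈ Icc (0 : ℝ) T, HasDerivWithinAt y (g (y t) t) (Icc 0 T) t) {N : ℕ}
    (P : Fin d → MvPolynomial (DiffIndex d N) ℝ) {C₁ : ℝ} (hC₁ : 0 ≤ C₁)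
    (hloc : ∀ t h, 0 ≤ t → 0 ≤ h → h ≤ 1 → t + h ≤ T →
      ‖y t + h • S.increment g (fun t => t) h t (y t) - y (t + h)
        - h ^ (p + 1) • evalPoly P (jet g (y t, t))‖ ≤ C₁ * h ^ (p + 2)) :
    ∃ C h₀, 0 ≤ C ∧ 0 < h₀ ∧ h₀ ≤ 1 ∧ ∀ h ∈ Ioo 0 h₀, ∀ e,
      SolvesVariational g (fun t => t) P h T (S.approx g (fun t => t) (y 0) h) e →
      (∀ t ∈ Icc 0 T, ‖e t‖ ≤ C) ∧ ∀ t ∈ Icc 0 T, (p = 1 ∨ ∃ n : ℕ, t = n * h) →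
        ‖S.approx g (fun t => t) (y 0) h t - y t - h ^ p • e t‖ ≤ C * h ^ (p + 1) := by
  have hyc : ContinuousOn y (Icc 0 T) := fun t ht => (hy t ht).continuousWithinAt
  obtain ⟨R, hR0, hR⟩ := exists_norm_prod_le_of_continuousOn hyc
  obtain ⟨BP, hBP0, hBP⟩ := ((contDiff_evalPoly P).continuous.comp
    (contDiff_jet hg N).continuous).exists_norm_le_of_norm_le R
  have hloc' : ∀ t h, 0 ≤ t → 0 ≤ h → h ≤ 1 → t + h ≤ T →
      ‖y t + h • S.increment g (fun t => t) h t (y t) - y (t + h)‖ ≤ (C₁ + BP) * h ^ (p + 1) := by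
    intro t h ht hh hh1 hth
    have h1 := hloc t h ht hh hh1 hth
    have h2 : ‖h ^ (p + 1) • evalPoly P (jet g (y t, t))‖ ≤ h ^ (p + 1) * BP := by
      rw [norm_smul, Real.norm_of_nonneg (pow_nonneg hh _)]
      gcongr
      exact hBP _ (hR t ⟨ht, by linarith⟩)
    have h3 := norm_le_norm_add_norm_sub' (y t + h • S.increment g (fun t => t) h t (y t)
      - y (t + h)) (h ^ (p + 1) • evalPoly P (jet g (y t, t)))
    have h4 : h ^ (p + 2) ≤ h ^ (p + 1) := pow_le_pow_of_le_one hh hh1 (by omega)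
    have h5 := mul_le_mul_of_nonneg_left h4 hC₁
    linarith
  obtain ⟨K, h₀, hK0, hh₀, hh₀1, hK⟩ := S.exists_norm_node_sub_le hp hg hT hy
    (add_nonneg hC₁ hBP0) hloc'
  obtain ⟨BΦ, hBΦ0, hBΦ⟩ :=
    (S.contDiff_increment_of_field hg).continuous.exists_norm_le_of_norm_le (R + 1)
  obtain ⟨Λ, hΛ0, hΛ⟩ := S.exists_norm_increment_lipschitz hg (R + 1)
  obtain ⟨C₆, hC₆0, hC₆⟩ := S.exists_norm_increment_linearization hb hg (R + 1) (by linarith)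
  obtain ⟨C₇, hC₇0, hC₇⟩ := exists_variational_estimates hg hyc P (add_nonneg hK0 hBΦ0)
  obtain ⟨KA, hKA0, hKA⟩ := (contDiff_fderiv_state hg).continuous.exists_norm_le_of_norm_le R
  -- The contributions of linearization, local error and Euler step for `e`; each step contributes
  -- `h * h ^ (p + 1)` times this constant.
  set ε := C₆ * (1 + K) * K + C₁ + C₇ with hε
  have hε0 : 0 ≤ ε := by positivity
  set C₈ := ε * T * Real.exp (KA * T) with hC₈
  have hC₈0 : 0 ≤ C₈ := by positivity
  refine ⟨C₈ + Λ * (1 + K) + (C₁ + BP) + C₇, h₀, by positivity, hh₀, hh₀1, fun h hh e he => ?_⟩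
  have hh0 : 0 < h := hh.1
  have hh1 : h ≤ 1 := hh.2.le.trans hh₀1
  have hhp : h ^ p ≤ h := pow_le_of_le_one hh0.le hh1 (by omega)
  set X : ℕ → State d := S.node g (fun t => t) (y 0) h with hX
  have hXK : ∀ n : ℕ, n * h ≤ T → ‖X n - y (n * h)‖ ≤ K * h ^ p := fun n hn => (hK h hh n hn).1
  have hgrid : ∀ n : ℕ, (n : ℝ) * h ≤ T → ‖y (n * h)‖ ≤ R ∧ |(n : ℝ) * h| ≤ R := fun n hn => by
    have := hR (n * h) ⟨by positivity, hn⟩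
    exact ⟨(norm_fst_le (y (n * h), (n : ℝ) * h)).trans this,
      (norm_snd_le (y (n * h), (n : ℝ) * h)).trans this⟩
  have hXR : ∀ n : ℕ, n * h ≤ T → ‖X n‖ ≤ R + 1 := fun n hn => by
    have h1 := (hK h hh n hn).1
    have h2 := (hK h hh n hn).2
    have h3 := norm_le_norm_add_norm_sub' (X n) (y (n * h))
    linarith [(hgrid n hn).1]
  have hhabs : |h| ≤ R + 1 := by rw [abs_of_pos hh0]; linarith
  have hfloor : ∀ t ∈ Icc 0 T, (⌊t / h⌋₊ : ℝ) * h ≤ t ∧ t < ⌊t / h⌋₊ * h + h := fun t ht => by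
    have h1 := Nat.floor_le (div_nonneg ht.1 hh0.le)
    have h2 := Nat.lt_floor_add_one (t / h)
    rw [le_div_iff₀ hh0] at h1
    rw [div_lt_iff₀ hh0] at h2
    exact ⟨h1, by linarith⟩
  have happrox : ∀ t ∈ Ico 0 T, ‖S.approx g (fun t => t) (y 0) h t - y (gridPoint h t)‖
      ≤ (K + BΦ) * h := by
    intro t ht
    obtain ⟨h1, h2⟩ := hfloor t ⟨ht.1, ht.2.le⟩
    rw [S.approx_eq g (fun t => t) (y 0) hh0.ne' t rfl, gridPoint]
    set n := ⌊t / h⌋₊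
    have hnT : n * h ≤ T := h1.trans ht.2.le
    have h3 := hBΦ (h, n * h, X n)
      (max_le hhabs (max_le ((hgrid n hnT).2.trans (by linarith)) (hXR n hnT)))
    rw [add_sub_right_comm, add_mul]
    refine (norm_add_le _ _).trans (add_le_add ((hXK n hnT).trans (by gcongr)) ?_)
    rw [norm_smul, Real.norm_of_nonneg (by linarith), mul_comm]
    exact mul_le_mul h3 (by linarith) (by linarith) hBΦ0
  obtain ⟨heC, helip, hestep⟩ := hC₇ h hh0 hh1 _ e happrox he
  have hnode : ∀ n : ℕ, n * h ≤ T → ‖X n - y (n * h) - h ^ p • e (n * h)‖ ≤ C₈ * h ^ (p + 1) := by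
    intro n hn
    -- The recursion holds unconditionally here, so the a priori bound is simply taken to be the
    -- conclusion.
    have := discrete_gronwall_bootstrap
      (a := fun n => ‖X n - y (n * h) - h ^ p • e (n * h)‖) (Λ := KA) (h := h)
      (ε := ε * h ^ (p + 1)) (T := T) (K := ε * h ^ (p + 1) * T * Real.exp (KA * T)) hh0.le hKA0
      (by positivity) (by simp [hX, node, he.2.1]) le_rfl ?_ n hn
    · calc _ ≤ _ := this
        _ = C₈ * h ^ (p + 1) := by rw [hC₈]; ring
    · intro n hn _
      have hn0 : (0 : ℝ) ≤ n * h := by positivity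
      have hsucc : ((n + 1 : ℕ) : ℝ) * h = n * h + h := by push_cast; ring
      rw [hsucc] at hn
      have hnT : (n : ℝ) * h ≤ T := by linarith
      change ‖S.node g (fun t => t) (y 0) h (n + 1) - y ((n + 1 : ℕ) * h)
        - h ^ p • e ((n + 1 : ℕ) * h)‖ ≤ _
      rw [hsucc, node]
      change ‖X n + h • S.increment g (fun t => t) h (n * h) (X n) - _ - _‖ ≤
        (1 + KA * h) * ‖X n - y (n * h) - h ^ p • e (n * h)‖ + _
      have h1 := hC₆ h (n * h) (y (n * h)) (X n) hh0.le hh1 (by linarith [(hgrid n hnT).2])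
        (by linarith [(hgrid n hnT).1]) (hXR n hnT)
      have h2 := hloc (n * h) h hn0 hh0.le hh1 hn
      have h3 := hestep n hn
      have h4 := hXK n hnT
      set τ := (n : ℝ) * h
      set A := fderiv ℝ (fun z => g z τ) (y τ) with hA
      have hAK : ‖A‖ ≤ KA := hKA (y τ, τ) (hR τ ⟨hn0, hnT⟩)
      set Φ := S.increment g (fun t => t) h τ with hΦ
      set π := evalPoly P (jet g (y τ, τ)) with hπ
      -- The terms `h ^ (p + 1) • π` and `h ^ p • (h • A (e τ))` cancel between the brackets. This
      -- leaves the linear propagation of the corrected error and three remainders of order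
      -- `h^(p+2)`.
      have heq : X n + h • Φ (X n) - y (τ + h) - h ^ p • e (τ + h)
          = ((X n - y τ - h ^ p • e τ) + h • A (X n - y τ - h ^ p • e τ))
            + h • (Φ (X n) - Φ (y τ) - A (X n - y τ))
            + ((y τ + h • Φ (y τ) - y (τ + h) - h ^ (p + 1) • π)
            - h ^ p • (e (τ + h) - e τ - h • (A (e τ) + π))) := by
        simp only [map_sub, map_smul, smul_sub, smul_add, smul_smul, pow_succ, mul_comm h]
        abel
      rw [heq]
      refine norm_add₃_le.trans ?_
      have b1 : ‖(X n - y τ - h ^ p • e τ) + h • A (X n - y τ - h ^ p • e τ)‖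
          ≤ (1 + KA * h) * ‖X n - y τ - h ^ p • e τ‖ := by
        refine (norm_add_le _ _).trans ?_
        rw [norm_smul, Real.norm_of_nonneg hh0.le, add_mul, one_mul, mul_comm KA, mul_assoc]
        gcongr
        exact A.le_of_opNorm_le hAK _
      have b2 : ‖h • (Φ (X n) - Φ (y τ) - A (X n - y τ))‖
          ≤ h * (C₆ * (1 + K) * K * h ^ (p + 1)) := by
        rw [norm_smul, Real.norm_of_nonneg hh0.le]
        gcongr
        calc _ ≤ C₆ * (h + ‖X n - y τ‖) * ‖X n - y τ‖ := h1
          _ ≤ C₆ * (h + K * h) * (K * h ^ p) := by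
            have : ‖X n - y τ‖ ≤ K * h := h4.trans (by gcongr)
            gcongr
          _ = _ := by ring
      have b3 : ‖(y τ + h • Φ (y τ) - y (τ + h) - h ^ (p + 1) • π)
          - h ^ p • (e (τ + h) - e τ - h • (A (e τ) + π))‖ ≤ h * ((C₁ + C₇) * h ^ (p + 1)) := by
        refine (norm_sub_le _ _).trans ?_
        rw [norm_smul, Real.norm_of_nonneg (pow_nonneg hh0.le _)]
        calc _ ≤ C₁ * h ^ (p + 2) + h ^ p * (C₇ * h ^ 2) := by gcongr
          _ = _ := by ring
      calc _ ≤ _ := add_le_add (add_le_add b1 b2) b3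
        _ = _ := by rw [hε]; ring
  refine ⟨fun t ht => (heC t ht).trans (by linarith [mul_nonneg hΛ0 (by linarith : 0 ≤ 1 + K)]),
    fun t ht hcase => ?_⟩
  -- For `p = 1` and a time `nh + r` inside a cell, the interpolant is a step of length `r` with the
  -- increment for step size `h`. Replacing that increment by the one for step size `r` at the exact
  -- solution changes it by `O(h)`, and the factor `r ≤ h` makes the cost `O(h^2)`.
  rcases hcase with rfl | ⟨n, rfl⟩
  · obtain ⟨h1, h2⟩ := hfloor t ht
    rw [S.approx_eq g (fun t => t) (y 0) hh0.ne' t rfl]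
    set n := ⌊t / h⌋₊
    have hnT : (n : ℝ) * h ≤ T := h1.trans ht.2
    have hn0 : (0 : ℝ) ≤ n * h := by positivity
    obtain ⟨r, hr⟩ : ∃ r, t = n * h + r := ⟨t - n * h, by ring⟩
    have hr0 : 0 ≤ r := by linarith
    have hrh : r ≤ h := by linarith
    have b1 := hnode n hnT
    have b2 := hΛ r h (n * h) (y (n * h)) (X n)
      (by rw [abs_of_nonneg hr0]; linarith) hhabs (by linarith [(hgrid n hnT).2])
      (by linarith [(hgrid n hnT).1]) (hXR n hnT)
    have b3 := hloc' (n * h) r hn0 hr0 (hrh.trans hh1) (by linarith [ht.2])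
    have b4 := helip (n * h) t hn0 h1 ht.2
    have b5 := hXK n hnT
    rw [hr] at b4 ⊢
    simp only [pow_one, add_sub_cancel_left] at *
    set τ := (n : ℝ) * h
    have heq : X n + r • S.increment g (fun t => t) h τ (X n) - y (τ + r) - h • e (τ + r)
        = (X n - y τ - h • e τ)
          + r • (S.increment g (fun t => t) h τ (X n) - S.increment g (fun t => t) r τ (y τ))
          + ((y τ + r • S.increment g (fun t => t) r τ (y τ) - y (τ + r))
          - h • (e (τ + r) - e τ)) := by
      simp only [smul_sub]
      abel
    change ‖X n + r • S.increment g (fun t => t) h τ (X n) - y (τ + r) - h • e (τ + r)‖ ≤ _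
    rw [heq]
    refine norm_add₃_le.trans ?_
    have c2 : ‖r • (S.increment g (fun t => t) h τ (X n) - S.increment g (fun t => t) r τ (y τ))‖
        ≤ h * (Λ * ((1 + K) * h)) := by
      rw [norm_smul, Real.norm_of_nonneg hr0]
      refine mul_le_mul hrh (b2.trans ?_) (norm_nonneg _) hh0.le
      gcongr
      refine max_le ?_ (b5.trans ?_)
      · rw [abs_of_nonneg (by linarith)]
        nlinarith
      · nlinarith
    have c3 : ‖(y τ + r • S.increment g (fun t => t) r τ (y τ) - y (τ + r))
          - h • (e (τ + r) - e τ)‖ ≤ (C₁ + BP) * h ^ (1 + 1) + h * (C₇ * h) := by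
      refine (norm_sub_le _ _).trans ?_
      rw [norm_smul, Real.norm_of_nonneg hh0.le]
      exact add_le_add (b3.trans (by gcongr)) (by gcongr; exact b4.trans (by gcongr))
    calc _ ≤ _ := add_le_add (add_le_add b1 c2) c3
      _ = _ := by ring
  · rw [S.approx_grid _ _ _ hh0]
    refine (hnode n ht.2).trans ?_
    gcongr
    linarith [mul_nonneg hΛ0 (by linarith : 0 ≤ 1 + K)]

end RKScheme

/-- Transfer of a first order expansion of a perturbed point to a function of that point. -/
theorem exists_abs_comp_sub_expansion_le {E : Type*} [NormedAddCommGroup E]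
    [InnerProductSpace ℝ E] [FiniteDimensional ℝ E] {L : E → ℝ} (hL : ContDiff ℝ 2 L) {p : ℕ}
    (hp : 1 ≤ p) {R C : ℝ} (hC : 0 ≤ C) :
    ∃ C', ∀ (x z w : E) (h : ℝ), 0 < h → h ≤ 1 → ‖x‖ ≤ R → ‖w‖ ≤ C →
      ‖z - x - h ^ p • w‖ ≤ C * h ^ (p + 1) →
      |L z - (L x + h ^ p * inner ℝ (gradient L x) w)| ≤ C' * h ^ (p + 1) := by
  have : ProperSpace E := FiniteDimensional.proper_real E
  obtain ⟨C₁, hC₁0, hC₁⟩ := hL.exists_norm_sub_sub_fderiv_le (R + 2 * C)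
  obtain ⟨B, hB0, hB⟩ := (hL.continuous_fderiv two_ne_zero).exists_norm_le_of_norm_le R
  refine ⟨C₁ * (2 * C) ^ 2 + B * C, fun x z w h hh hh1 hx hw hz => ?_⟩
  have hgrad : inner ℝ (gradient L x) w = fderiv ℝ L x w := by
    rw [gradient, InnerProductSpace.toDual_symm_apply]
  have hpow : h ^ (p + 1) ≤ h ^ p := pow_le_pow_of_le_one hh.le hh1 (by omega)
  have hzx : ‖z - x‖ ≤ 2 * C * h ^ p := by
    have h1 := norm_le_norm_add_norm_sub' (z - x) (h ^ p • w)
    rw [norm_smul, Real.norm_of_nonneg (pow_nonneg hh.le _)] at h1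
    have h2 : h ^ p * ‖w‖ ≤ h ^ p * C := by gcongr
    have h3 : C * h ^ (p + 1) ≤ C * h ^ p := by gcongr
    linarith
  have hp1 : h ^ p ≤ 1 := pow_le_one₀ hh.le hh1
  have hzR : ‖z‖ ≤ R + 2 * C := by
    have h1 := norm_le_norm_add_norm_sub' z x
    have h2 : 2 * C * h ^ p ≤ 2 * C := mul_le_of_le_one_right (by positivity) hp1
    linarith
  have h1 := hC₁ x z (by linarith) hzR
  have heq : L z - (L x + h ^ p * inner ℝ (gradient L x) w)
      = (L z - L x - fderiv ℝ L x (z - x)) + fderiv ℝ L x (z - x - h ^ p • w) := by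
    rw [hgrad, map_sub _ _ (h ^ p • w), map_smul, smul_eq_mul]
    ring
  rw [heq, add_mul]
  refine (abs_add_le _ _).trans (add_le_add (h1.trans ?_) ?_)
  -- The quadratic Taylor remainder is `O(h^(2p))`, and `2p ≥ p + 1` because `p ≥ 1`.
  · calc _ ≤ C₁ * (2 * C * h ^ p) ^ 2 := by gcongr
      _ = C₁ * (2 * C) ^ 2 * h ^ (p * 2) := by rw [mul_pow, ← pow_mul]; ring
      _ ≤ _ := mul_le_mul_of_nonneg_left (pow_le_pow_of_le_one hh.le hh1 (by omega))
        (by positivity)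
  · rw [mul_assoc]
    exact ((fderiv ℝ L x).le_of_opNorm_le (hB x hx) _).trans (by gcongr)

theorem theorem1 {s p : ℕ} (hp : 1 ≤ p) (S : RKScheme s) (hS : S.HasOrder p) (d : ℕ) :
    ∃ P : Fin d → MvPolynomial (DiffIndex d (p + 1)) ℝ,
      (∀ i, MvPolynomial.eval (fun _ => (0 : ℝ)) (P i) = 0) ∧
      ∀ (q : ℕ) (f : State d → EuclideanSpace ℝ (Fin q) → State d)
        (θ : ℝ → EuclideanSpace ℝ (Fin q)) (T : ℝ) (y₀ : State d),
        0 < T →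
        ContDiff ℝ ∞ (fun x : State d × ℝ => f x.1 (θ x.2)) →
        (∃ y : ℝ → State d, y 0 = y₀ ∧
          ∀ t ∈ Icc (0 : ℝ) T, HasDerivWithinAt y (f (y t) (θ t)) (Icc 0 T) t) →
        ∃ (ybar : ℝ → State d) (e : ℝ → ℝ → State d),
          ContDiffOn ℝ ∞ ybar (Icc 0 T) ∧
          (∀ h : ℝ, 0 < h → SolvesVariational f θ P h T (S.approx f θ y₀ h) (e h)) ∧
          ∀ L : State d → ℝ, ContDiff ℝ 2 L →
            ∃ C h₀ : ℝ, 0 < h₀ ∧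
              ∀ h ∈ Ioo (0 : ℝ) h₀, ∀ t ∈ Icc (0 : ℝ) T,
                (p = 1 ∨ ∃ n : ℕ, t = n * h) →
                |L (S.approx f θ y₀ h t)
                    - (L (ybar t) + h ^ p * inner ℝ (gradient L (ybar t)) (e h t))|
                  ≤ C * h ^ (p + 1) := by
  obtain ⟨P, hP0, hP⟩ := S.exists_principal_localError hS d
  refine ⟨P, hP0, fun q f θ T y₀ hT hf ⟨y, hy0, hy⟩ => ?_⟩
  subst hy0
  -- The control is absorbed into a time-dependent field; only joint smoothness of the composite is
  -- needed, not that of `f` and `θ` separately.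
  obtain ⟨C₁, hC₁0, hC₁⟩ := hP (fun x t => f x (θ t)) y T hT hf hy
  have hsmooth : ContDiffOn ℝ ∞ y (Icc 0 T) :=
    ODE.contDiffOn_enat_Icc_of_hasDerivWithinAt (n := ⊤) (f := fun t x => f x (θ t)) (u := univ)
      (hf.comp (contDiff_snd.prodMk contDiff_fst)).contDiffOn hy (mapsTo_univ _ _)
  have hex : ∀ h : ℝ, 0 < h → ∃ e, SolvesVariational (fun x t => f x (θ t)) (fun t => t) P h T
      (S.approx (fun x t => f x (θ t)) (fun t => t) (y 0) h) e := fun h hh =>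
    S.exists_solvesVariational hf P (y 0) hh T
  choose! e he using hex
  refine ⟨y, e, hsmooth, fun h hh => ?_, fun L hL => ?_⟩
  · have := he h hh
    rwa [S.approx_comp] at this
  · obtain ⟨C, h₀, hC0, hh₀, hh₀1, hC⟩ := S.exists_globalError_expansion hp (S.sum_b_eq_one hS hp)
      hf hT hy P hC₁0 hC₁
    obtain ⟨R, hR0, hR⟩ := exists_norm_prod_le_of_continuousOn hsmooth.continuousOn
    obtain ⟨C', hC'⟩ := exists_abs_comp_sub_expansion_le hL hp hC0
    refine ⟨C', h₀, hh₀, fun h hh t ht hcase => ?_⟩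
    obtain ⟨h1, h2⟩ := hC h hh (e h) (he h hh.1)
    have h3 := h2 t ht hcase
    rw [S.approx_comp] at h3
    exact hC' (y t) _ (e h t) h hh.1 (hh.2.le.trans hh₀1)
      ((norm_fst_le (y t, t)).trans (hR t ht)) (h1 t ht) h3
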